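/- \textbf{Setting.} Let $\mathcal R$ be the space of finite point measures $\mathbf s=\sum_{i=1}^{n}\delta_{s_i}$ ($n\ge 0$) on $(0,\infty)$, with the Borel $\sigma$-algebra of the weak topology; write $\sharp\mathbf s=n$ and $\langle f,\mathbf s\rangle=\sum_{i=1}^n f(s_i)$. Let $\alpha\ge 0$ and let $\nu$ be a probability measure on $\mathcal R$. Put $$\underline p=\inf\Big\{p\in\mathbb R:\int_{\mathcal R}\langle x^p,\mathbf s\rangle\,\nu(d\mathbf s)<\infty\Big\},\qquad p_\infty=\inf\Big\{p>\underline p:\int_{\mathcal R}\langle x^p,\mathbf s\rangle\,\nu(d\mathbf s)=\infty\Big\}$$ (in $[-\infty,\infty]$, $\inf\emptyset=\infty$), and $\kappa(p)=\int_{\mathcal R}(1-\langle x^p,\mathbf s\rangle)\,\nu(d\mathbf s)$ for $p\in(\underline p,p_\infty)$. Assume: (1) $\kappa$ has a smallest zero $p_0$ in $(\underline p,p_\infty)$, $p_0>0$, $\kappa(p)>0$ for some $p\in(\underline p,p_\infty)$ with $p>p_0$, and $\int_{\mathcal R}\langle x^{p_0},\mathbf s\rangle^p\,\nu(d\mathbf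 s)<\infty$ for some $p>1$; (2) with $F(u)=\int_{\mathcal R}u^{\sharp\mathbf s}\,\nu(d\mathbf s)$, for every $\epsilon\in(0,1)$, $\int_{1-\epsilon}^1\frac{du}{|F(u)-u|}=\infty$ (where $1/0=\infty$). Let $\mathcal U=\bigcup_{n\ge0}\mathbb N^n$ be the Ulam--Harris tree. On a probability space, let $(\overline\xi_u)_{u\in\mathcal U}$ and $(\mathbf e_u)_{u\in\mathcal U}$ be two independent families of i.i.d. variables, where $\mathbf e_u$ is exponential with parameter $1$ and $\overline\xi_u=(\widetilde\xi_{ui})_{i\in\mathbb N}$ is a random sequence of law $\nu$; that is, almost surely there is a (random) finite number $n$ with $\widetilde\xi_{ui}>0$ for $i\le n$ and $\widetilde\xi_{ui}=0$ for $i>n$, and $\sum_{i\le n}\delta_{\widetilde\xi_{ui}}$ has law $\nu$. Fix $x>0$ and define recursively $\xi_\emptyset=x$, $a_\emptyset=0$, $\zeta_u=\xi_u^{-\alpha}\mathbf e_u$, $\xi_{ui}=\widetilde\xi_{ui}\,\xi_u$, $a_{ui}=a_u+\zeta_u$. Let $I_u=[a_u,a_u+\zeta_u)$ if $\xi_u>0$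 and $I_u=\emptyset$ otherwise. For $t\ge0$ let $$\mathbf X(t)=\sum_{u\in\mathcal U}\mathbf 1_{\{t\in I_u\}}\delta_{\xi_u},\qquad M(t)=\langle x^{p_0},\mathbf X(t)\rangle=\sum_{u\in\mathcal U}\mathbf 1_{\{t\in I_u\}}\xi_u^{p_0},$$ let $\mathcal F_t=\sigma(\mathbf X(s):s\le t)$, let $M_n=\sum_{|u|=n}\xi_u^{p_0}$ for $n\ge0$, and let $M_\infty=\lim_{n\to\infty}M_n$. \textbf{Statement.} For every $t\ge 0$ the sum defining $M(t)$ is almost surely finite; the limit $M_\infty$ exists almost surely and is integrable; $(M(t))_{t\ge0}$ is a martingale in the filtration $(\mathcal F_t)_{t\ge0}$; for every $t\ge0$, almost surely, $$M(t)=\mathbb E(M_\infty\mid\mathcal F_t);$$ and there is $p>1$ such that $M_\infty\in L^p$, $M(t)\in L^p$ for all $t\ge0$, and $M(t)\to M_\infty$ in $L^p$ as $t\to\infty$. -/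

import Mathlib

open MeasureTheory ProbabilityTheory Filter Topology
open scoped NNReal ENNReal

noncomputable section

namespace BranchingChain

/-! ### Finite point measures on `(0, ∞)` -/

/-- A finite point measure on `(0, ∞)`: a finite sum of Dirac masses at positive reals,
regarded as a measure on `ℝ`. -/
def IsFinitePointMeasure (μ : Measure ℝ) : Prop :=
  ∃ (n : ℕ) (s : Fin n → ℝ), (∀ i, 0 < s i) ∧ μ = ∑ i, Measure.dirac (s i)

/-- The space of finite point measures on `(0, ∞)`, with the σ-algebra generated by the maps
`s ↦ s(B)` for `B` Borel, which is the Borel σ-algebra of the topology of weak convergence. -/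
abbrev PointMeasure : Type := {μ : Measure ℝ // IsFinitePointMeasure μ}

/-- `⟨f, s⟩`, the sum of `f` over the atoms of `s` repeated with their multiplicity. -/
def pairing (f : ℝ → ℝ) (s : Measure ℝ) : ℝ := ∫ y, f y ∂s

/-- The number of atoms of `s`, as a real number. -/
def numAtoms (s : PointMeasure) : ℝ := s.1.real Set.univ

/-! ### Malthusian hypotheses and the condition on the generating function -/

/-- The `ν`-integral of `⟨x ^ p, s⟩`, with values in `[0, ∞]`. -/
def powerMoment (ν : Measure PointMeasure) (p : ℝ) : ℝ≥0∞ :=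
  ∫⁻ s, (∫⁻ y, ENNReal.ofReal (y ^ p) ∂s.1) ∂ν

/-- The infimum of the `p ∈ ℝ` such that the moment of order `p` is finite. -/
def pLower (ν : Measure PointMeasure) : EReal :=
  sInf ((fun p : ℝ => (p : EReal)) '' {p : ℝ | powerMoment ν p < ∞})

/-- The infimum of the `p > pLower ν` such that the moment of order `p` is infinite. -/
def pUpper (ν : Measure PointMeasure) : EReal :=
  sInf ((fun p : ℝ => (p : EReal)) '' {p : ℝ | pLower ν < p ∧ powerMoment ν p = ∞})

/-- The open interval `(pLower ν, pUpper ν)`. -/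
def kappaDomain (ν : Measure PointMeasure) : Set ℝ :=
  {p : ℝ | pLower ν < p ∧ (p : EReal) < pUpper ν}

/-- `κ(p) = ∫ (1 - ⟨x ^ p, s⟩) ν(ds)`, used for `p ∈ kappaDomain ν`. -/
def kappa (ν : Measure PointMeasure) (p : ℝ) : ℝ :=
  ∫ s, (1 - pairing (fun y => y ^ p) s.1) ∂ν

/-- `p₀` is the Malthusian exponent: the smallest zero of `κ`. -/
def IsMalthusianExponent (ν : Measure PointMeasure) (p₀ : ℝ) : Prop :=
  IsLeast {p : ℝ | p ∈ kappaDomain ν ∧ kappa ν p = 0} p₀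

structure MalthusianHypotheses (ν : Measure PointMeasure) (p₀ : ℝ) : Prop where
  isMalthusianExponent : IsMalthusianExponent ν p₀
  pos : 0 < p₀
  kappa_pos : ∃ p ∈ kappaDomain ν, p₀ < p ∧ 0 < kappa ν p
  moment : ∃ p : ℝ, 1 < p ∧
    ∫⁻ s, (∫⁻ y, ENNReal.ofReal (y ^ p₀) ∂s.1) ^ p ∂ν < ∞

/-- `F(u) = ∫ u ^ (number of atoms of s) ν(ds)` for `u ≥ 0`. -/
def generatingFunction (ν : Measure PointMeasure) (u : ℝ) : ℝ :=
  ∫ s, u ^ numAtoms s ∂ν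

/-- `∫_{1-ε}^1 du / |F(u) - u| = ∞` for all small `ε`, where `1 / 0 = ∞`. -/
def NonExplosionCondition (ν : Measure PointMeasure) : Prop :=
  ∀ ε : ℝ, 0 < ε → ε < 1 →
    ∫⁻ u in Set.Ioo (1 - ε) 1, (ENNReal.ofReal |generatingFunction ν u - u|)⁻¹ = ∞

/-! ### The marked tree -/

/-- Nodes of the Ulam–Harris tree. The root is `[]`, and `i :: u` is the child of `u` with
index `i`, so the word of a node is read from right to left, with letters numbered from `0`. -/
abbrev Node : Type := List ℕ

/-- The point measure formed by the positive terms of a sequence. -/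
def atomsOf (s : ℕ → ℝ) : Measure ℝ :=
  open Classical in
  Measure.sum fun i => if 0 < s i then Measure.dirac (s i) else 0

/-- A random sequence `Y` has the law `ν`: almost surely its first terms (finitely many, in random
number) are positive and all others vanish, and the point measure of its positive terms is
distributed as `ν`. -/
structure HasReproductionLaw {Ω : Type*} [MeasurableSpace Ω] (P : Measure Ω)
    (ν : Measure PointMeasure) (Y : Ω → ℕ → ℝ) : Prop where
  eventually_zero : ∀ᵐ ω ∂P, ∃ n : ℕ, ∀ i, 0 ≤ Y ω i ∧ (Y ω i = 0 ↔ n ≤ i)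
  map_eq : P.map (fun ω => atomsOf (Y ω)) = ν.map Subtype.val

/-- The two independent families of i.i.d. variables indexed by the nodes: `ξt u ω i` is the ratio
of the size of the `i`-th child of `u` to that of `u`, and `e u` is a standard exponential. -/
structure IsTreeInput {Ω : Type*} [MeasurableSpace Ω] (P : Measure Ω)
    (ν : Measure PointMeasure) (ξt : Node → Ω → ℕ → ℝ) (e : Node → Ω → ℝ) : Prop where
  measurable_ratio : ∀ u, Measurable (ξt u)
  measurable_exp : ∀ u, Measurable (e u)
  iIndep_ratio : iIndepFun ξt P
  iIndep_exp : iIndepFun e P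
  indep : IndepFun (fun ω u => ξt u ω) (fun ω u => e u ω) P
  identDistrib_ratio : ∀ u v, IdentDistrib (ξt u) (ξt v) P P
  law_ratio : ∀ u, HasReproductionLaw P ν (ξt u)
  law_exp : ∀ u, P.map (e u) = expMeasure 1

section Tree

variable {Ω : Type*} (α x : ℝ) (ξt : Node → Ω → ℕ → ℝ) (e : Node → Ω → ℝ)

/-- The size of an individual, for a root of size `x`. -/
def size : Node → Ω → ℝ
  | [], _ => x
  | i :: u, ω => ξt u ω i * size u ω

/-- The lifetime of an individual. (Its value is irrelevant for individuals of size `0`, which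
are never alive and have only descendants of size `0`.) -/
def lifetime (u : Node) (ω : Ω) : ℝ := size x ξt u ω ^ (-α) * e u ω

/-- The birth time of an individual. -/
def birth : Node → Ω → ℝ
  | [], _ => 0
  | _ :: u, ω => birth u ω + lifetime α x ξt e u ω

/-- The individual `u` has positive size and `t ∈ [a_u, a_u + ζ_u)`. -/
def Alive (t : ℝ≥0) (u : Node) (ω : Ω) : Prop :=
  0 < size x ξt u ω ∧
    (t : ℝ) ∈ Set.Ico (birth α x ξt e u ω) (birth α x ξt e u ω + lifetime α x ξt e u ω)

/-- The process `X(t)`, the sum of the Dirac masses at the sizes of the individuals alive at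
time `t`. -/
def X (t : ℝ≥0) (ω : Ω) : Measure ℝ :=
  open Classical in
  Measure.sum fun u : Node =>
    if Alive α x ξt e t u ω then Measure.dirac (size x ξt u ω) else 0

/-- `M(t) = ⟨x ^ p₀, X(t)⟩`. -/
def M (p₀ : ℝ) (t : ℝ≥0) (ω : Ω) : ℝ :=
  pairing (fun y => y ^ p₀) (X α x ξt e t ω)

/-- The intrinsic martingale: `M_n` is the sum of `ξ_u ^ p₀` over the `n`-th generation. -/
def genM (p₀ : ℝ) (n : ℕ) (ω : Ω) : ℝ :=
  ∑' u : {u : Node // u.length = n}, size x ξt u ω ^ p₀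

/-- The terminal value of the intrinsic martingale. -/
def genMLimit (p₀ : ℝ) (ω : Ω) : ℝ :=
  limUnder atTop fun n => genM x ξt p₀ n ω

variable [MeasurableSpace Ω] {ξt e}

lemma measurable_size (hξ : ∀ u, Measurable (ξt u)) (u : Node) : Measurable (size x ξt u) := by
  induction u with
  | nil => exact measurable_const
  | cons i u ih => exact ((measurable_pi_apply i).comp (hξ u)).mul ih

lemma measurable_lifetime (hξ : ∀ u, Measurable (ξt u)) (he : ∀ u, Measurable (e u)) (u : Node) :
    Measurable (lifetime α x ξt e u) :=
  ((measurable_size x hξ u).pow_const (-α)).mul (he u)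

lemma measurable_birth (hξ : ∀ u, Measurable (ξt u)) (he : ∀ u, Measurable (e u)) (u : Node) :
    Measurable (birth α x ξt e u) := by
  induction u with
  | nil => exact measurable_const
  | cons i u ih => exact ih.add (measurable_lifetime α x hξ he u)

lemma measurableSet_alive (hξ : ∀ u, Measurable (ξt u)) (he : ∀ u, Measurable (e u))
    (t : ℝ≥0) (u : Node) : MeasurableSet {ω | Alive α x ξt e t u ω} :=
  (measurableSet_lt measurable_const (measurable_size x hξ u)).inter
    ((measurableSet_le (measurable_birth α x hξ he u) measurable_const).inter
      (measurableSet_lt measurable_const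
        ((measurable_birth α x hξ he u).add (measurable_lifetime α x hξ he u))))

lemma measurable_X (hξ : ∀ u, Measurable (ξt u)) (he : ∀ u, Measurable (e u)) (t : ℝ≥0) :
    Measurable (X α x ξt e t) := by
  classical
  refine Measure.measurable_of_measurable_coe _ fun s hs => ?_
  simp only [X, Measure.sum_apply _ hs]
  refine Measurable.tsum fun u => ?_
  refine (Measure.measurable_coe hs).comp ?_
  exact Measurable.ite (measurableSet_alive α x hξ he t u)
    (Measure.measurable_dirac.comp (measurable_size x hξ u)) measurable_const

/-- The natural filtration of `X`: `F_t` is generated by the `X(s)` with `s ≤ t`. -/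
def natFiltration (hξ : ∀ u, Measurable (ξt u)) (he : ∀ u, Measurable (e u)) :
    Filtration ℝ≥0 (inferInstance : MeasurableSpace Ω) where
  seq t := ⨆ s : ℝ≥0, ⨆ _ : s ≤ t, MeasurableSpace.comap (X α x ξt e s) inferInstance
  mono' _ _ hst := iSup₂_mono' fun r hr => ⟨r, hr.trans hst, le_rfl⟩
  le' _ := iSup₂_le fun s _ => (measurable_X α x hξ he s).comap_le

end Tree

end BranchingChain

end

open BranchingChain

/-! Call `ξ_u ^ p₀` the weight of `u`. Replacing `u` by its children changes the total weight by
`increment`, the weight of `u` times an excess that depends only on the offspring of `u`. The excess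
is centred because `κ(p₀) = 0`, and it is independent of all the other inputs.

Telescoping over the individuals of generation less than `n` that die after time `t` gives `M_n -
lineSum = ∑ increment` (`hasSum_genM_sub_lineSum`), where `lineSum` is the weight present at time
`t` when the tree is cut at generation `n`. As `n → ∞`, `lineSum` tends to `M(t)`, provided that
late generations carry no weight before time `t`. This follows from the finiteness of the mean of `∑
exp(-a_u) ξ_u ^ p₀` (`tsum_lintegral_exp_neg_birth_ne_top`): an individual of size at most `1` lives
at least as long as its exponential clock, while large sizes are controlled by a moment of order `p
* p₀` that is less than `1`.

Up to time `t` the process does not see the offspring of an individual that dies after `t`, so each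
of these increments integrates to zero over every event of `F_t`
(`setIntegral_diesAfter_increment`). Letting `n → ∞`, `M(t)` and `M_∞` have the same integral over
every such event. This is the conditional expectation formula, and the tower property makes `M` a
martingale.

For the `L^p` statements, convexity of moments in their order provides `p ∈ (1, 2]` with moment of
order `p * p₀` less than `1` (`exists_exponent`). A von Bahr–Esseen inequality then bounds the
`p`-th moment of a sum of increments by a constant times the mean of the sum of `ξ_u ^ (p * p₀)`
over the same nodes (`lintegral_tsum_increment_rpow_le`). Over the whole tree this mean is a
convergent geometric series, and its part due to individuals dying after `t` vanishes as `t → ∞`. -/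

namespace BranchingChain

/-! ### A pointwise inequality -/

lemma rpow_sub_rpow_le {a b r : ℝ} (ha : 0 ≤ a) (hab : a ≤ b) (h0 : 0 ≤ r) (h1 : r ≤ 1) :
    b ^ r - a ^ r ≤ (b - a) ^ r := by
  lift a to ℝ≥0 using ha
  obtain ⟨c, rfl⟩ : ∃ c : ℝ≥0, b = a + c :=
    ⟨(b - a).toNNReal, by rw [Real.coe_toNNReal _ (sub_nonneg.2 hab)]; ring⟩
  have := NNReal.rpow_add_le_add_rpow a c h0 h1
  have h2 : ((a : ℝ) + c) ^ r ≤ (a : ℝ) ^ r + (c : ℝ) ^ r := by exact_mod_cast this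
  simpa using by linarith

lemma abs_rpow_sub_two_mul {a p : ℝ} (ha : 0 ≤ a) (hp : 1 < p) :
    |a| ^ (p - 2) * a = a ^ (p - 1) := by
  rcases ha.eq_or_lt with rfl | ha
  · rw [mul_zero, Real.zero_rpow (by linarith)]
  · rw [abs_of_pos ha, show p - 1 = p - 2 + 1 by ring, Real.rpow_add_one ha.ne']

/-- Hölder continuity of the derivative of `|y| ^ p / p`. For arguments of the same sign it is the
subadditivity of the power `p - 1 ≤ 1`. For opposite signs each of the two terms is at most `|b - a|
^ (p - 1)`, whence the factor `2`. -/
lemma abs_rpow_mul_sub_le {p : ℝ} (hp1 : 1 < p) (hp2 : p ≤ 2) (a b : ℝ) :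
    |(|b| ^ (p - 2) * b - |a| ^ (p - 2) * a)| ≤ 2 * |b - a| ^ (p - 1) := by
  wlog hab : a ≤ b generalizing a b
  · rw [abs_sub_comm, abs_sub_comm b a]
    exact this b a (le_of_not_ge hab)
  have key : ∀ a b : ℝ, 0 ≤ a → a ≤ b →
      |(|b| ^ (p - 2) * b - |a| ^ (p - 2) * a)| ≤ 2 * |b - a| ^ (p - 1) := by
    intro a b ha hab
    have hp : (0 : ℝ) ≤ (b - a) ^ (p - 1) := Real.rpow_nonneg (sub_nonneg.2 hab) _
    rw [abs_rpow_sub_two_mul ha hp1, abs_rpow_sub_two_mul (ha.trans hab) hp1,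
      abs_of_nonneg (sub_nonneg.2 (Real.rpow_le_rpow ha hab (by linarith))),
      abs_of_nonneg (sub_nonneg.2 hab)]
    linarith [rpow_sub_rpow_le ha hab (r := p - 1) (by linarith) (by linarith)]
  rcases le_total 0 a with ha | ha
  · exact key a b ha hab
  rcases le_total b 0 with hb | hb
  · have := key (-b) (-a) (by linarith) (by linarith)
    simpa only [abs_neg, mul_neg, neg_sub_neg] using this
  · have h1 := abs_rpow_sub_two_mul hb hp1
    have h2 := abs_rpow_sub_two_mul (neg_nonneg.2 ha) hp1
    rw [abs_neg, mul_neg] at h2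
    have h3 : b ^ (p - 1) ≤ (b - a) ^ (p - 1) :=
      Real.rpow_le_rpow hb (by linarith) (by linarith)
    have h4 : (-a) ^ (p - 1) ≤ (b - a) ^ (p - 1) :=
      Real.rpow_le_rpow (by linarith) (by linarith) (by linarith)
    have h5 : 0 ≤ b ^ (p - 1) := Real.rpow_nonneg hb _
    have h6 : 0 ≤ (-a) ^ (p - 1) := Real.rpow_nonneg (by linarith) _
    rw [abs_of_nonneg (sub_nonneg.2 hab), abs_of_nonneg (by linarith)]
    linarith

/-- The pointwise inequality behind the von Bahr–Esseen bound. -/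
lemma abs_add_rpow_le {p : ℝ} (hp1 : 1 < p) (hp2 : p ≤ 2) (a b : ℝ) :
    |a + b| ^ p ≤ |a| ^ p + p * (|a| ^ (p - 2) * a * b) + 2 * p * |b| ^ p := by
  have hb0 : ∀ y ∈ Set.uIcc a (a + b), |y - a| ≤ |b| := fun y hy => by
    simpa using Set.abs_sub_left_of_mem_uIcc hy
  -- Mean value inequality on the segment from `a` to `a + b` for `|y| ^ p` minus its linear part at
  -- `a`; the derivative of this difference is bounded by the Hölder estimate.
  have := (convex_uIcc a (a + b)).norm_image_sub_le_of_norm_hasDerivWithin_le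
    (f := fun y => |y| ^ p - p * (|a| ^ (p - 2) * a) * y)
    (f' := fun y => p * |y| ^ (p - 2) * y - p * (|a| ^ (p - 2) * a))
    (C := 2 * p * |b| ^ (p - 1))
    (fun y _ => ((hasDerivAt_abs_rpow y hp1).sub (by
      simpa using (hasDerivAt_id y).const_mul (p * (|a| ^ (p - 2) * a)))).hasDerivWithinAt)
    (fun y hy => by
      rw [Real.norm_eq_abs, mul_assoc, ← mul_sub, abs_mul, abs_of_pos (by linarith : 0 < p)]
      have h1 := abs_rpow_mul_sub_le hp1 hp2 a y
      have h2 : |y - a| ^ (p - 1) ≤ |b| ^ (p - 1) :=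
        Real.rpow_le_rpow (abs_nonneg _) (hb0 y hy) (by linarith)
      nlinarith)
    Set.left_mem_uIcc Set.right_mem_uIcc
  simp only [add_sub_cancel_left, Real.norm_eq_abs] at this
  have h3 : |b| ^ (p - 1) * |b| = |b| ^ p := by
    rcases eq_or_ne b 0 with rfl | hb
    · simp [Real.zero_rpow (by linarith : p ≠ 0)]
    · rw [← Real.rpow_add_one (abs_pos.2 hb).ne', sub_add_cancel]
  have h4 := (le_abs_self _).trans this
  rw [mul_assoc (2 * p), h3] at h4
  linarith

/-! ### Independence of one member of a family from all other inputs -/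

/-- Both hypotheses together say that the joint law of `a`, `b`, `c` is the product of the three
laws; it remains to reassociate the product. -/
lemma indepFun_prod_right_of_prod_left {Ω A B C : Type*} [MeasurableSpace Ω] {P : Measure Ω}
    [IsProbabilityMeasure P] [MeasurableSpace A] [MeasurableSpace B]
    [MeasurableSpace C] {a : Ω → A} {b : Ω → B} {c : Ω → C} (ha : Measurable a)
    (hb : Measurable b) (hc : Measurable c) (hab : IndepFun a b P)
    (habc : IndepFun (fun ω => (a ω, b ω)) c P) : IndepFun a (fun ω => (b ω, c ω)) P := by
  have := Measure.isProbabilityMeasure_map (μ := P) ha.aemeasurable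
  have := Measure.isProbabilityMeasure_map (μ := P) hb.aemeasurable
  have := Measure.isProbabilityMeasure_map (μ := P) hc.aemeasurable
  have hbc : IndepFun b c P := habc.comp measurable_snd measurable_id
  rw [indepFun_iff_map_prod_eq_prod_map_map ha.aemeasurable (hb.prodMk hc).aemeasurable,
    (indepFun_iff_map_prod_eq_prod_map_map hb.aemeasurable hc.aemeasurable).1 hbc,
    ← Measure.prodAssoc_prod,
    ← (indepFun_iff_map_prod_eq_prod_map_map ha.aemeasurable hb.aemeasurable).1 hab,
    ← (indepFun_iff_map_prod_eq_prod_map_map (ha.prodMk hb).aemeasurable hc.aemeasurable).1 habc,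
    Measure.map_map MeasurableEquiv.prodAssoc.measurable ((ha.prodMk hb).prodMk hc)]
  rfl

section Indep

variable {Ω ι E G : Type*} [MeasurableSpace Ω] {P : Measure Ω}
  [MeasurableSpace E] [Zero E] [MeasurableSpace G] [DecidableEq ι] {f : ι → Ω → E} {g : Ω → G}

lemma measurable_update_zero (hf : ∀ i, Measurable (f i)) (u v : ι) :
    Measurable (Function.update f u 0 v) := by
  rcases eq_or_ne v u with rfl | h
  · simp [measurable_zero]
  · simpa [h] using hf v

/-- The `u`-th member is overwritten by `0` instead of being removed from the index set, so that the
recursions for sizes and birth times still apply to the remaining family. -/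
lemma indepFun_update_prod [IsProbabilityMeasure P] (hf : ∀ i, Measurable (f i))
    (hg : Measurable g) (hfi : iIndepFun f P)
    (hfg : IndepFun (fun ω i => f i ω) g P) (u : ι) :
    IndepFun (f u) (fun ω => (fun v => Function.update f u 0 v ω, g ω)) P := by
  have hu := measurable_update_zero hf u
  refine indepFun_prod_right_of_prod_left (hf u) (measurable_pi_lambda _ hu) hg ?_ ?_
  · have := indep_iSup_of_disjoint (fun i => (hf i).comap_le) hfi.iIndep
      (S := {u}) (T := {u}ᶜ) (by simp)
    rw [IndepFun_iff_Indep]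
    refine indep_of_indep_of_le this (by simp) ?_
    rw [← measurable_iff_comap_le]
    refine @measurable_pi_lambda _ _ _ (_) _ _ fun v => ?_
    rcases eq_or_ne v u with rfl | h
    · simp
    · simp only [Function.update_of_ne h]
      rw [measurable_iff_comap_le]
      exact le_iSup₂_of_le v h le_rfl
  · have h2 : Measurable fun F : ι → E => (F u, fun v => if v = u then (0 : E) else F v) := by
      refine (measurable_pi_apply u).prodMk (measurable_pi_lambda _ fun v => ?_)
      split_ifs
      · exact measurable_const
      · exact measurable_pi_apply v
    have h3 := hfg.comp h2 measurable_id
    refine h3.congr (ae_of_all _ fun ω => ?_) (ae_of_all _ fun ω => rfl)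
    refine Prod.ext rfl (funext fun v => ?_)
    simp only [Function.update_apply, Function.comp_apply]
    split_ifs <;> rfl

end Indep

/-! ### Moments of the reproduction law -/

lemma measurable_ofReal_rpow (r : ℝ) : Measurable fun y : ℝ => ENNReal.ofReal (y ^ r) :=
  (measurable_id.pow_const r).ennreal_ofReal

lemma measurable_lintegral_rpow (r : ℝ) :
    Measurable fun s : PointMeasure => ∫⁻ y, ENNReal.ofReal (y ^ r) ∂s.1 :=
  (Measure.measurable_lintegral (measurable_ofReal_rpow r)).comp measurable_subtype_coe

lemma PointMeasure.ae_pos (s : PointMeasure) : ∀ᵐ y ∂s.1, 0 < y := by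
  obtain ⟨μ, n, a, ha, rfl⟩ := s
  simp only
  rw [ae_iff, Measure.finsetSum_apply]
  refine Finset.sum_eq_zero fun i _ => ?_
  rw [Measure.dirac_apply' _ (by measurability)]
  simp [ha i]

lemma pairing_rpow_eq_toReal {μ : Measure ℝ} (h : ∀ᵐ y ∂μ, 0 < y) (r : ℝ) :
    pairing (fun y => y ^ r) μ = (∫⁻ y, ENNReal.ofReal (y ^ r) ∂μ).toReal :=
  integral_eq_lintegral_of_nonneg_ae (h.mono fun _ hy => Real.rpow_nonneg hy.le r)
    (measurable_id.pow_const r).aestronglyMeasurable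

variable {ν : Measure PointMeasure}

lemma powerMoment_ne_top {p : ℝ} (hp : p ∈ kappaDomain ν) : powerMoment ν p ≠ ∞ := fun h =>
  (hp.2.trans_le (sInf_le ⟨p, ⟨hp.1, h⟩, rfl⟩)).false

lemma kappa_eq [IsProbabilityMeasure ν] {p : ℝ} (hp : p ∈ kappaDomain ν) :
    kappa ν p = 1 - (powerMoment ν p).toReal := by
  have hm := (measurable_lintegral_rpow p).aemeasurable (μ := ν)
  have hfin := powerMoment_ne_top hp
  simp only [kappa, pairing_rpow_eq_toReal (PointMeasure.ae_pos _)]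
  rw [integral_sub (integrable_const _) (integrable_toReal_of_lintegral_ne_top hm hfin),
    integral_toReal hm (ae_lt_top' hm hfin)]
  simp [powerMoment]

/-- Convexity of `r ↦ exp (r * log y)`. -/
lemma ofReal_rpow_le_interp {a b r y : ℝ} (hab : a < b) (har : a ≤ r) (hrb : r ≤ b)
    (hy : 0 < y) : ENNReal.ofReal (y ^ r) ≤
      ENNReal.ofReal ((b - r) / (b - a)) * ENNReal.ofReal (y ^ a) +
        ENNReal.ofReal ((r - a) / (b - a)) * ENNReal.ofReal (y ^ b) := by
  have h0 : 0 < b - a := sub_pos.2 hab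
  have hl : 0 ≤ (b - r) / (b - a) := div_nonneg (sub_nonneg.2 hrb) h0.le
  have hl' : 0 ≤ (r - a) / (b - a) := div_nonneg (sub_nonneg.2 har) h0.le
  have h1 : (b - r) / (b - a) + (r - a) / (b - a) = 1 := by field_simp; ring
  rw [← ENNReal.ofReal_mul hl, ← ENNReal.ofReal_mul hl', ← ENNReal.ofReal_add (by positivity)
    (by positivity)]
  refine ENNReal.ofReal_le_ofReal ?_
  have := convexOn_exp.2 (Set.mem_univ (Real.log y * a)) (Set.mem_univ (Real.log y * b)) hl hl' h1
  simp only [smul_eq_mul] at this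
  rw [Real.rpow_def_of_pos hy, Real.rpow_def_of_pos hy, Real.rpow_def_of_pos hy]
  refine le_trans (le_of_eq ?_) this
  congr 1
  field_simp
  ring

lemma powerMoment_le_interp {a b r : ℝ} (hab : a < b) (har : a ≤ r) (hrb : r ≤ b) :
    powerMoment ν r ≤ ENNReal.ofReal ((b - r) / (b - a)) * powerMoment ν a +
      ENNReal.ofReal ((r - a) / (b - a)) * powerMoment ν b := by
  simp only [powerMoment]
  rw [← lintegral_const_mul _ (measurable_lintegral_rpow a),
    ← lintegral_const_mul _ (measurable_lintegral_rpow b),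
    ← lintegral_add_left ((measurable_lintegral_rpow a).const_mul _)]
  refine lintegral_mono fun s => ?_
  rw [← lintegral_const_mul _ (measurable_ofReal_rpow a),
    ← lintegral_const_mul _ (measurable_ofReal_rpow b),
    ← lintegral_add_left ((measurable_ofReal_rpow a).const_mul _)]
  exact lintegral_mono_ae (s.ae_pos.mono fun y hy => ofReal_rpow_le_interp hab har hrb hy)

lemma MalthusianHypotheses.powerMoment_eq_one [IsProbabilityMeasure ν] {p₀ : ℝ}
    (h : MalthusianHypotheses ν p₀) : powerMoment ν p₀ = 1 := by
  have h0 := h.isMalthusianExponent.1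
  have := kappa_eq h0.1
  rw [h0.2] at this
  rw [← ENNReal.ofReal_toReal (powerMoment_ne_top h0.1)]
  simp [show (powerMoment ν p₀).toReal = 1 by linarith]

/-- The moment is `1` at `p₀` and less than `1` at some `b > p₀` where `κ(b) > 0`, so by
interpolation it is less than `1` on all of `(p₀, b]`. -/
lemma MalthusianHypotheses.exists_exponent [IsProbabilityMeasure ν] {p₀ : ℝ}
    (h : MalthusianHypotheses ν p₀) : ∃ p : ℝ, 1 < p ∧ p ≤ 2 ∧ powerMoment ν (p * p₀) < 1 ∧
      ∫⁻ s, (∫⁻ y, ENNReal.ofReal (y ^ p₀) ∂s.1) ^ p ∂ν < ∞ := by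
  obtain ⟨b, hb, hpb, hkb⟩ := h.kappa_pos
  obtain ⟨p', hp', hm⟩ := h.moment
  have hp0 := h.pos
  have hb1 : 1 < b / p₀ := (one_lt_div hp0).2 hpb
  -- The three bounds serve the von Bahr–Esseen inequality, the inequality `p * p₀ ≤ b`, and the
  -- `p`-th moment of `⟨x ^ p₀, s⟩`.
  refine ⟨min 2 (min (b / p₀) p'), by simp [hb1, hp'], min_le_left _ _, ?_, ?_⟩
  · set p := min 2 (min (b / p₀) p')
    have hp : 1 < p := by simp [p, hb1, hp']
    have hle : p * p₀ ≤ b := by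
      rw [← le_div_iff₀ hp0]
      exact (min_le_right _ _).trans (min_le_left _ _)
    have hlt : p₀ < p * p₀ := by nlinarith
    have hbm : powerMoment ν b < 1 := by
      rw [kappa_eq hb] at hkb
      rw [← ENNReal.ofReal_toReal (powerMoment_ne_top hb), ENNReal.ofReal_lt_one]
      linarith
    refine (powerMoment_le_interp hpb hlt.le hle).trans_lt ?_
    rw [h.powerMoment_eq_one, mul_one]
    have h0 : 0 < b - p₀ := sub_pos.2 hpb
    have hpos : 0 < (p * p₀ - p₀) / (b - p₀) := div_pos (sub_pos.2 hlt) h0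
    calc _ < ENNReal.ofReal ((b - p * p₀) / (b - p₀)) +
          ENNReal.ofReal ((p * p₀ - p₀) / (b - p₀)) * 1 := by
          refine ENNReal.add_lt_add_left ENNReal.ofReal_ne_top ?_
          exact ENNReal.mul_lt_mul_right (by simpa using hpos) ENNReal.ofReal_ne_top hbm
      _ = 1 := by
          rw [mul_one, ← ENNReal.ofReal_add (div_nonneg (sub_nonneg.2 hle) h0.le) hpos.le,
            ← add_div, sub_add_sub_cancel, div_self h0.ne', ENNReal.ofReal_one]
  · have hmin : min 2 (min (b / p₀) p') ≤ p' := (min_le_right _ _).trans (min_le_right _ _)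
    have hmin0 : 0 ≤ min 2 (min (b / p₀) p') := by
      simp only [le_min_iff]; exact ⟨by norm_num, by linarith, by linarith⟩
    calc _ ≤ ∫⁻ s, (1 + (∫⁻ y, ENNReal.ofReal (y ^ p₀) ∂s.1) ^ p') ∂ν := by
          refine lintegral_mono fun s => ?_
          rcases le_total (∫⁻ y, ENNReal.ofReal (y ^ p₀) ∂s.1) 1 with h1 | h1
          · exact (ENNReal.rpow_le_one h1 hmin0).trans le_self_add
          · exact (ENNReal.rpow_le_rpow_of_exponent_le h1 hmin).trans le_add_self
      _ < ∞ := by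
          rw [lintegral_add_left measurable_const]
          simpa using hm

/-! ### From the law of the offspring sequence to the reproduction law -/

/-- The sum of the `r`-th powers of a sequence of nonnegative reals, in `[0, ∞]`. -/
noncomputable def powerSum (r : ℝ) (s : ℕ → ℝ) : ℝ≥0∞ := ∑' i, ENNReal.ofReal (s i ^ r)

lemma measurable_powerSum (r : ℝ) : Measurable (powerSum r) :=
  Measurable.tsum fun i => (measurable_ofReal_rpow r).comp (measurable_pi_apply i)

lemma measurable_atomsOf : Measurable atomsOf := by
  classical
  refine Measure.measurable_of_measurable_coe _ fun s hs => ?_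
  simp only [atomsOf, Measure.sum_apply _ hs]
  refine Measurable.tsum fun i => (Measure.measurable_coe hs).comp ?_
  exact Measurable.ite (measurableSet_lt measurable_const (measurable_pi_apply i))
    (Measure.measurable_dirac.comp (measurable_pi_apply i)) measurable_const

/-- The zeros that pad the sequence contribute nothing to the power sum because `0 ^ r = 0` for `r >
0`. -/
lemma lintegral_atomsOf {s : ℕ → ℝ} (hs : ∀ i, 0 ≤ s i) {r : ℝ} (hr : 0 < r) :
    ∫⁻ y, ENNReal.ofReal (y ^ r) ∂(atomsOf s) = powerSum r s := by
  rw [atomsOf, lintegral_sum_measure, powerSum]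
  refine tsum_congr fun i => ?_
  split_ifs with h
  · exact lintegral_dirac' _ (measurable_ofReal_rpow r)
  · simp [le_antisymm (not_lt.1 h) (hs i), Real.zero_rpow hr.ne']

lemma lintegral_comp_powerSum {Ω : Type*} [MeasurableSpace Ω] {P : Measure Ω}
    {Y : Ω → ℕ → ℝ} (hY : Measurable Y) (h : HasReproductionLaw P ν Y) {r : ℝ} (hr : 0 < r)
    {Φ : ℝ≥0∞ → ℝ≥0∞} (hΦ : Measurable Φ) :
    ∫⁻ ω, Φ (powerSum r (Y ω)) ∂P = ∫⁻ s, Φ (∫⁻ y, ENNReal.ofReal (y ^ r) ∂s.1) ∂ν := by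
  have hg : Measurable fun μ : Measure ℝ => Φ (∫⁻ y, ENNReal.ofReal (y ^ r) ∂μ) :=
    hΦ.comp (Measure.measurable_lintegral (measurable_ofReal_rpow r))
  rw [← lintegral_map (f := fun μ : Measure ℝ => Φ (∫⁻ y, ENNReal.ofReal (y ^ r) ∂μ)) hg
    measurable_subtype_coe, ← h.map_eq,
    lintegral_map hg (show Measurable fun ω => atomsOf (Y ω) from measurable_atomsOf.comp hY)]
  refine lintegral_congr_ae (h.eventually_zero.mono fun ω hω => ?_)
  obtain ⟨n, hn⟩ := hω
  simp only [lintegral_atomsOf (fun i => (hn i).1) hr]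

/-! ### Sums over the nodes of the tree -/

lemma cons_uncurry_injective : Function.Injective fun z : Node × ℕ => (z.2 :: z.1 : Node) := by
  rintro ⟨u, i⟩ ⟨v, j⟩ h
  simp only [List.cons.injEq] at h
  exact Prod.ext h.2 h.1

lemma support_subset_range_cons {R : Type*} [Zero R] {f : Node → R} (h : f [] = 0) :
    Function.support f ⊆ Set.range fun z : Node × ℕ => (z.2 :: z.1 : Node) := by
  rintro (_ | ⟨i, u⟩) hu
  · exact absurd h hu
  · exact ⟨(u, i), rfl⟩

lemma tsum_node_eq_tsum_cons {f : Node → ℝ≥0∞} (h : f [] = 0) :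
    ∑' v, f v = ∑' u, ∑' i, f (i :: u) := by
  rw [← ENNReal.tsum_prod (f := fun u i => f (i :: u)),
    ← cons_uncurry_injective.tsum_eq (support_subset_range_cons h)]

lemma tsum_node_eq_tsum_cons_real {f : Node → ℝ} (h : f [] = 0) (hf : Summable f) :
    ∑' v, f v = ∑' u, ∑' i, f (i :: u) := by
  rw [← cons_uncurry_injective.tsum_eq (support_subset_range_cons h)]
  exact (hf.comp_injective cons_uncurry_injective).tsum_prod

/-- The sum over a generation. -/
noncomputable def genSum (n : ℕ) (f : Node → ℝ≥0∞) : ℝ≥0∞ :=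
  ∑' u : Node, if u.length = n then f u else 0

lemma genSum_succ (n : ℕ) (f : Node → ℝ≥0∞) :
    genSum (n + 1) f = genSum n fun u => ∑' i, f (i :: u) := by
  rw [genSum, tsum_node_eq_tsum_cons (by simp)]
  refine tsum_congr fun u => ?_
  by_cases h : u.length = n <;> simp [h]

lemma genSum_zero (f : Node → ℝ≥0∞) : genSum 0 f = f [] := by
  rw [genSum, tsum_eq_single []]
  · simp
  · intro u hu
    simp [hu]

lemma genSum_mono {n : ℕ} {f g : Node → ℝ≥0∞} (h : ∀ u, f u ≤ g u) :
    genSum n f ≤ genSum n g :=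
  ENNReal.tsum_le_tsum fun u => by split_ifs <;> simp [h]

lemma genSum_add (n : ℕ) (f g : Node → ℝ≥0∞) :
    genSum n (fun u => f u + g u) = genSum n f + genSum n g := by
  rw [genSum, genSum, genSum, ← ENNReal.tsum_add]
  exact tsum_congr fun u => by split_ifs <;> simp

lemma genSum_const_mul (n : ℕ) (c : ℝ≥0∞) (f : Node → ℝ≥0∞) :
    genSum n (fun u => c * f u) = c * genSum n f := by
  rw [genSum, genSum, ← ENNReal.tsum_mul_left]
  exact tsum_congr fun u => by split_ifs <;> simp

lemma tsum_genSum (f : Node → ℝ≥0∞) : ∑' n, genSum n f = ∑' u, f u := by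
  simp only [genSum]
  rw [ENNReal.tsum_comm]
  exact tsum_congr fun u => by simp [eq_comm]

lemma lintegral_genSum {Ω : Type*} [MeasurableSpace Ω] {P : Measure Ω} {f : Node → Ω → ℝ≥0∞}
    (hf : ∀ u, AEMeasurable (f u) P) (n : ℕ) :
    ∫⁻ ω, genSum n (fun u => f u ω) ∂P = genSum n fun u => ∫⁻ ω, f u ω ∂P := by
  simp only [genSum]
  rw [lintegral_tsum fun u => by split_ifs; exacts [hf u, aemeasurable_const]]
  exact tsum_congr fun u => by split_ifs <;> simp

/-- Summing the recursion gives `∑ r ≤ ρ ∑ r + r 0 + ∑ k`, and the term `ρ ∑ r` can be absorbed on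
the left since `ρ < 1`. -/
lemma tsum_ne_top_of_le_mul_add {r k : ℕ → ℝ≥0∞} {ρ : ℝ≥0∞} (hρ : ρ < 1) (h0 : r 0 ≠ ∞)
    (hk : ∑' n, k n ≠ ∞) (h : ∀ n, r (n + 1) ≤ ρ * r n + k n) : ∑' n, r n ≠ ∞ := by
  have hρ' : ρ ≠ ∞ := (hρ.trans ENNReal.one_lt_top).ne
  have hfin : ∀ n, r n ≠ ∞ := fun n => by
    induction n with
    | zero => exact h0
    | succ n ih =>
      exact ne_top_of_le_ne_top (ENNReal.add_ne_top.2 ⟨ENNReal.mul_ne_top hρ' ih,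
        ne_top_of_le_ne_top hk (ENNReal.le_tsum n)⟩) (h n)
  refine ne_top_of_le_ne_top (b := (r 0 + ∑' n, k n) / (1 - ρ)) ?_ ?_
  · exact ENNReal.div_ne_top (ENNReal.add_ne_top.2 ⟨h0, hk⟩) (tsub_pos_of_lt hρ).ne'
  rw [ENNReal.tsum_eq_iSup_nat]
  refine iSup_le fun N => ?_
  -- The absorption is carried out on partial sums, where the quantity to be cancelled is finite.
  have hS : ∑ n ∈ Finset.range N, r n ≠ ∞ := ENNReal.sum_ne_top.2 fun n _ => hfin n
  rw [ENNReal.le_div_iff_mul_le (Or.inl (tsub_pos_of_lt hρ).ne')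
    (Or.inl (ENNReal.sub_ne_top ENNReal.one_ne_top))]
  have h1 : ∑ n ∈ Finset.range N, r n ≤
      ρ * ∑ n ∈ Finset.range N, r n + (r 0 + ∑' n, k n) := by
    calc _ ≤ ∑ n ∈ Finset.range (N + 1), r n :=
          Finset.sum_le_sum_of_subset (Finset.range_mono N.le_succ)
      _ = ∑ n ∈ Finset.range N, r (n + 1) + r 0 := Finset.sum_range_succ' _ _
      _ ≤ (ρ * ∑ n ∈ Finset.range N, r n + ∑' n, k n) + r 0 := by
          gcongr
          calc _ ≤ ∑ n ∈ Finset.range N, (ρ * r n + k n) := Finset.sum_le_sum fun n _ => h n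
            _ ≤ _ := by
              rw [Finset.sum_add_distrib, Finset.mul_sum]
              gcongr
              exact ENNReal.sum_le_tsum _
      _ = _ := by ring
  have h2 : (∑ n ∈ Finset.range N, r n) * (1 - ρ) + ρ * ∑ n ∈ Finset.range N, r n =
      ∑ n ∈ Finset.range N, r n := by
    rw [mul_comm ρ, ← mul_add, tsub_add_cancel_of_le hρ.le, mul_one]
  rw [← ENNReal.add_le_add_iff_right (ENNReal.mul_ne_top hρ' hS), h2, add_comm (r 0 + _)]
  exact h1

/-! ### Dependence of an individual on the inputs of its strict ancestors -/

section Deterministic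

variable {Ω : Type*} {α x : ℝ} {ξt ξt' : Node → Ω → ℕ → ℝ} {e e' : Node → Ω → ℝ}

/-- Words are read from right to left, so the strict ancestors of `v` are exactly its strict
suffixes. -/
lemma size_congr {v : Node} {ω : Ω}
    (h : ∀ w, w <:+ v → w ≠ v → ξt w ω = ξt' w ω) : size x ξt v ω = size x ξt' v ω := by
  induction v with
  | nil => rfl
  | cons i v ih =>
    rw [size, size, h v (List.suffix_cons i v) (by simp), ih fun w hw hne => ?_]
    refine h w (hw.trans (List.suffix_cons i v)) ?_
    rintro rfl
    exact absurd hw.length_le (by simp)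

lemma birth_congr {v : Node} {ω : Ω} (h : ∀ w, w <:+ v → w ≠ v → ξt w ω = ξt' w ω)
    (h' : ∀ w, w <:+ v → w ≠ v → e w ω = e' w ω) :
    birth α x ξt e v ω = birth α x ξt' e' v ω := by
  induction v with
  | nil => rfl
  | cons i v ih =>
    have key : ∀ w, w <:+ v → w <:+ i :: v ∧ w ≠ i :: v := fun w hw =>
      ⟨hw.trans (List.suffix_cons i v), by rintro rfl; exact absurd hw.length_le (by simp)⟩
    rw [birth, birth, lifetime, lifetime, h' v (key v List.suffix_rfl).1 (key v List.suffix_rfl).2,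
      ih (fun w hw _ => h w (key w hw).1 (key w hw).2)
        (fun w hw _ => h' w (key w hw).1 (key w hw).2),
      size_congr fun w hw _ => h w (key w hw).1 (key w hw).2]

/-- Overwriting the offspring of `u` by zeros removes all its strict descendants from the
population. -/
lemma size_update_eq_zero {u v : Node} (h : u <:+ v) (hne : u ≠ v) (ω : Ω) :
    size x (Function.update ξt u 0) v ω = 0 := by
  induction v with
  | nil => exact absurd (List.suffix_nil.1 h) hne
  | cons i v ih =>
    rw [size]
    rcases List.suffix_cons_iff.1 h with h | h
    · exact absurd h hne
    · by_cases huv : u = v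
      · simp [huv]
      · rw [ih h huv, mul_zero]

/-- The inputs are in their range: all ratios are nonnegative and all exponentials positive. -/
def GoodInput (ξt : Node → Ω → ℕ → ℝ) (e : Node → Ω → ℝ) (ω : Ω) : Prop :=
  ∀ u, (∀ i, 0 ≤ ξt u ω i) ∧ 0 < e u ω

variable {ω : Ω}

lemma GoodInput.size_nonneg (h : GoodInput ξt e ω) (hx : 0 < x) (u : Node) :
    0 ≤ size x ξt u ω := by
  induction u with
  | nil => exact hx.le
  | cons i u ih => exact mul_nonneg ((h u).1 i) ih

lemma GoodInput.lifetime_nonneg (h : GoodInput ξt e ω) (hx : 0 < x) (u : Node) :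
    0 ≤ lifetime α x ξt e u ω :=
  mul_nonneg (Real.rpow_nonneg (h.size_nonneg hx u) _) (h u).2.le

lemma GoodInput.birth_nonneg (h : GoodInput ξt e ω) (hx : 0 < x) (u : Node) :
    0 ≤ birth α x ξt e u ω := by
  induction u with
  | nil => exact le_rfl
  | cons i u ih => exact add_nonneg ih (h.lifetime_nonneg hx u)

lemma GoodInput.death_le_birth (h : GoodInput ξt e ω) (hx : 0 < x) {u v : Node}
    (huv : u <:+ v) (hne : u ≠ v) :
    birth α x ξt e u ω + lifetime α x ξt e u ω ≤ birth α x ξt e v ω := by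
  induction v with
  | nil => exact absurd (List.suffix_nil.1 huv) hne
  | cons i v ih =>
    rcases List.suffix_cons_iff.1 huv with h1 | h1
    · exact absurd h1 hne
    · by_cases h2 : u = v
      · rw [h2]; rfl
      · exact (ih h1 h2).trans (le_add_of_nonneg_right (h.lifetime_nonneg hx v))

end Deterministic

/-! ### The inputs of all nodes but one -/

section OtherInputs

variable {Ω E G : Type*} [Zero E] [MeasurableSpace E] [MeasurableSpace G]
  {f : Node → Ω → E} {g : Node → Ω → G}

/-- The σ-algebra generated by the family `f` without its `u`-th member and the family `g`. -/
@[reducible]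
def otherInputs (f : Node → Ω → E) (g : Node → Ω → G) (u : Node) : MeasurableSpace Ω :=
  MeasurableSpace.comap (fun ω => (fun v => Function.update f u 0 v ω, fun v => g v ω))
    inferInstance

lemma measurable_otherInputs_update (u v : Node) :
    Measurable[otherInputs f g u] (Function.update f u 0 v) :=
  ((measurable_pi_apply (X := fun _ : Node => E) v).comp
    (measurable_fst (β := Node → G))).comp (comap_measurable _)

lemma measurable_otherInputs_right (u v : Node) : Measurable[otherInputs f g u] (g v) :=
  ((measurable_pi_apply (X := fun _ : Node => G) v).comp
    (measurable_snd (α := Node → E))).comp (comap_measurable _)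

lemma otherInputs_le [mΩ : MeasurableSpace Ω] (hf : ∀ u, Measurable (f u))
    (hg : ∀ u, Measurable (g u)) (u : Node) : otherInputs f g u ≤ mΩ :=
  ((measurable_pi_lambda _ (measurable_update_zero hf u)).prodMk
    (measurable_pi_lambda _ hg)).comap_le

end OtherInputs

section Tree

variable {Ω : Type*} {α x : ℝ} {ξt : Node → Ω → ℕ → ℝ} {e : Node → Ω → ℝ}

/-- When `u` is not a strict ancestor of `v`, overwriting the offspring of `u` leaves the size of
`v` unchanged, and the overwritten input is measurable by construction. -/
lemma measurable_otherInputs_size {u v : Node} (h : ¬(u <:+ v ∧ u ≠ v)) :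
    Measurable[otherInputs ξt e u] (size x ξt v) := by
  have h1 : size x ξt v = size x (Function.update ξt u 0) v := funext fun ω =>
    size_congr fun w hw hne => by
      rw [Function.update_of_ne]
      rintro rfl
      exact h ⟨hw, hne⟩
  rw [h1]
  exact @measurable_size Ω x _ (otherInputs ξt e u) (measurable_otherInputs_update u) v

lemma measurable_otherInputs_birth {u v : Node} (h : ¬(u <:+ v ∧ u ≠ v)) :
    Measurable[otherInputs ξt e u] (birth α x ξt e v) := by
  have h1 : birth α x ξt e v = birth α x (Function.update ξt u 0) e v := funext fun ω =>
    birth_congr (fun w hw hne => by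
      rw [Function.update_of_ne]
      rintro rfl
      exact h ⟨hw, hne⟩) fun _ _ _ => rfl
  rw [h1]
  exact @measurable_birth Ω α x _ _ (otherInputs ξt e u) (measurable_otherInputs_update u)
    (measurable_otherInputs_right u) v

lemma measurable_otherInputs_lifetime {u v : Node} (h : ¬(u <:+ v ∧ u ≠ v)) :
    Measurable[otherInputs ξt e u] (lifetime α x ξt e v) :=
  Measurable.fun_mul
    ((measurable_id.pow_const (-α)).comp (measurable_otherInputs_size h))
    (measurable_otherInputs_right u v)

/-- Here the two families exchange roles: the exponential of `u` is left out, and all the ratios are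
kept. -/
lemma measurable_otherInputs_exp_size (u v : Node) :
    Measurable[otherInputs e ξt u] (size x ξt v) :=
  @measurable_size Ω x _ (otherInputs e ξt u) (measurable_otherInputs_right u) v

lemma measurable_otherInputs_exp_birth (u : Node) :
    Measurable[otherInputs e ξt u] (birth α x ξt e u) := by
  have h1 : birth α x ξt e u = birth α x ξt (Function.update e u 0) u := funext fun ω =>
    birth_congr (fun _ _ _ => rfl) fun w _ hne => by rw [Function.update_of_ne hne]
  rw [h1]
  exact @measurable_birth Ω α x _ _ (otherInputs e ξt u) (measurable_otherInputs_right u)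
    (measurable_otherInputs_update u) u

lemma not_suffix_and_ne_self (u : Node) : ¬(u <:+ u ∧ u ≠ u) := fun h => h.2 rfl

/-! ### Moments of the sizes -/

/-- The `r`-th power of the size of an individual, in `[0, ∞]`. -/
noncomputable def mass (x : ℝ) (ξt : Node → Ω → ℕ → ℝ) (r : ℝ) (u : Node) (ω : Ω) : ℝ≥0∞ :=
  ENNReal.ofReal (size x ξt u ω ^ r)

lemma GoodInput.mass_cons {ω : Ω} (h : GoodInput ξt e ω) (hx : 0 < x) (r : ℝ) (i : ℕ) (u : Node) :
    mass x ξt r (i :: u) ω = mass x ξt r u ω * ENNReal.ofReal (ξt u ω i ^ r) := by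
  rw [mass, mass, size, Real.mul_rpow ((h u).1 i) (h.size_nonneg hx u), mul_comm,
    ENNReal.ofReal_mul (Real.rpow_nonneg (h.size_nonneg hx u) r)]

/-- If the size is at most `1`, then its power `-α` is at least `1` and the lifetime is at least `e
u`, which gives the first term. If the size is at least `1`, the exponential factor is dropped and
the power is raised from `p` to `q`. -/
lemma GoodInput.exp_neg_lifetime_mul_mass_le {ω : Ω} (hω : GoodInput ξt e ω) (hα : 0 ≤ α)
    (hx : 0 < x)
    {p q : ℝ} (hp : 0 < p) (hpq : p ≤ q) (u : Node) :
    ENNReal.ofReal (Real.exp (-(birth α x ξt e u ω + lifetime α x ξt e u ω))) * mass x ξt p u ω ≤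
      ENNReal.ofReal (Real.exp (-birth α x ξt e u ω)) * mass x ξt p u ω *
        ENNReal.ofReal (Real.exp (-e u ω)) + mass x ξt q u ω := by
  have hs := hω.size_nonneg hx u
  have hb := hω.birth_nonneg (α := α) hx u
  have hl := hω.lifetime_nonneg (α := α) hx u
  rcases hs.eq_or_lt with h0 | h0
  · simp [mass, ← h0, Real.zero_rpow hp.ne']
  rcases le_total (size x ξt u ω) 1 with h1 | h1
  · refine le_add_right ?_
    rw [mul_right_comm, ← ENNReal.ofReal_mul (Real.exp_nonneg _), ← Real.exp_add]
    gcongr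
    have h2 : 1 ≤ size x ξt u ω ^ (-α) :=
      Real.one_le_rpow_of_pos_of_le_one_of_nonpos h0 h1 (by linarith)
    have h3 : e u ω ≤ lifetime α x ξt e u ω := le_mul_of_one_le_left (hω u).2.le h2
    linarith
  · refine le_add_left ?_
    calc _ ≤ 1 * mass x ξt p u ω := by
          gcongr
          rw [ENNReal.ofReal_le_one, Real.exp_le_one_iff]
          linarith
      _ ≤ _ := by
          rw [one_mul]
          exact ENNReal.ofReal_le_ofReal (Real.rpow_le_rpow_of_exponent_le h1 hpq)

lemma measurable_otherInputs_mass {u v : Node} (h : ¬(u <:+ v ∧ u ≠ v)) (r : ℝ) :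
    Measurable[otherInputs ξt e u] (mass x ξt r v) :=
  (measurable_ofReal_rpow r).comp (measurable_otherInputs_size h)

variable [MeasurableSpace Ω] {P : Measure Ω} {ν : Measure PointMeasure}

lemma measurable_mass (h : ∀ u, Measurable (ξt u)) (r : ℝ) (u : Node) :
    Measurable (mass x ξt r u) :=
  (measurable_ofReal_rpow r).comp (measurable_size x h u)

lemma ae_pos_expMeasure : ∀ᵐ y ∂(expMeasure 1), 0 < y := by
  have hI := isProbabilityMeasure_expMeasure (r := 1) one_pos
  rw [ae_iff]
  have h1 : {y : ℝ | ¬0 < y} = Set.Iic 0 := by ext; simp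
  have h2 : (expMeasure 1).real (Set.Iic 0) = 0 := by
    rw [← cdf_eq_real, cdf_expMeasure_eq one_pos]
    simp
  rw [h1]
  exact (measureReal_eq_zero_iff).1 h2

namespace IsTreeInput

lemma ae_goodInput (h : IsTreeInput P ν ξt e) : ∀ᵐ ω ∂P, GoodInput ξt e ω := by
  refine ae_all_iff.2 fun u => ?_
  have h1 : ∀ᵐ ω ∂P, 0 < e u ω := by
    have := ae_pos_expMeasure
    rw [← h.law_exp u] at this
    exact ae_of_ae_map (h.measurable_exp u).aemeasurable this
  filter_upwards [(h.law_ratio u).eventually_zero, h1] with ω ⟨n, hn⟩ h2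
  exact ⟨fun i => (hn i).1, h2⟩

lemma lintegral_powerSum (h : IsTreeInput P ν ξt e) (u : Node) {r : ℝ} (hr : 0 < r) :
    ∫⁻ ω, powerSum r (ξt u ω) ∂P = powerMoment ν r :=
  lintegral_comp_powerSum (h.measurable_ratio u) (h.law_ratio u) hr measurable_id

lemma lintegral_exp_neg_eq (h : IsTreeInput P ν ξt e) (u v : Node) :
    ∫⁻ ω, ENNReal.ofReal (Real.exp (-e u ω)) ∂P =
      ∫⁻ ω, ENNReal.ofReal (Real.exp (-e v ω)) ∂P := by
  have h1 : Measurable fun y : ℝ => ENNReal.ofReal (Real.exp (-y)) := by fun_prop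
  rw [← lintegral_map (f := fun y : ℝ => ENNReal.ofReal (Real.exp (-y))) h1 (h.measurable_exp u),
    ← lintegral_map (f := fun y : ℝ => ENNReal.ofReal (Real.exp (-y))) h1 (h.measurable_exp v),
    h.law_exp, h.law_exp]

variable [IsProbabilityMeasure P]

lemma indep_ratio (h : IsTreeInput P ν ξt e) (u : Node) :
    Indep (otherInputs ξt e u) (MeasurableSpace.comap (ξt u) inferInstance) P :=
  (indepFun_update_prod h.measurable_ratio (measurable_pi_lambda _ h.measurable_exp)
    h.iIndep_ratio h.indep u).symm

lemma indep_exp (h : IsTreeInput P ν ξt e) (u : Node) :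
    Indep (otherInputs e ξt u) (MeasurableSpace.comap (e u) inferInstance) P :=
  (indepFun_update_prod h.measurable_exp (measurable_pi_lambda _ h.measurable_ratio)
    h.iIndep_exp h.indep.symm u).symm

lemma lintegral_mul_comp_ratio (h : IsTreeInput P ν ξt e) {u : Node} {f : Ω → ℝ≥0∞}
    (hf : Measurable[otherInputs ξt e u] f) {k : (ℕ → ℝ) → ℝ≥0∞} (hk : Measurable k) :
    ∫⁻ ω, f ω * k (ξt u ω) ∂P = (∫⁻ ω, f ω ∂P) * ∫⁻ ω, k (ξt u ω) ∂P :=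
  lintegral_mul_eq_lintegral_mul_lintegral_of_independent_measurableSpace
    (otherInputs_le h.measurable_ratio h.measurable_exp u) (h.measurable_ratio u).comap_le
    (h.indep_ratio u) hf (hk.comp (comap_measurable _))

/-- One step of the branching property. The factor `f` may involve the lifetime of `u` itself, since
only the offspring of `u` has to be independent of it. -/
lemma tsum_lintegral_children (h : IsTreeInput P ν ξt e) (hx : 0 < x) {u : Node} {f : Ω → ℝ≥0∞}
    (hf : Measurable[otherInputs ξt e u] f) {r : ℝ} (hr : 0 < r) :
    ∑' i, ∫⁻ ω, f ω * mass x ξt r (i :: u) ω ∂P =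
      powerMoment ν r * ∫⁻ ω, f ω * mass x ξt r u ω ∂P := by
  have hf' : Measurable f :=
    hf.mono (otherInputs_le h.measurable_ratio h.measurable_exp u) le_rfl
  have h1 : Measurable[otherInputs ξt e u] fun ω => f ω * mass x ξt r u ω :=
    Measurable.fun_mul hf
      (measurable_otherInputs_mass (not_suffix_and_ne_self u) r)
  rw [← lintegral_tsum fun i => (hf'.fun_mul (measurable_mass h.measurable_ratio r _)).aemeasurable,
    mul_comm, ← h.lintegral_powerSum u hr, ← h.lintegral_mul_comp_ratio h1 (measurable_powerSum r)]
  refine lintegral_congr_ae (h.ae_goodInput.mono fun ω hω => ?_)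
  simp only [hω.mass_cons hx, powerSum, ENNReal.tsum_mul_left, mul_assoc]

lemma genSum_lintegral_mass (h : IsTreeInput P ν ξt e) (hx : 0 < x) {r : ℝ} (hr : 0 < r) (n : ℕ) :
    genSum n (fun u => ∫⁻ ω, mass x ξt r u ω ∂P) =
      powerMoment ν r ^ n * ENNReal.ofReal (x ^ r) := by
  induction n with
  | zero => simp [genSum_zero, mass, size]
  | succ n ih =>
    rw [genSum_succ, pow_succ', mul_assoc, ← ih, ← genSum_const_mul]
    congr 1
    funext u
    simpa using h.tsum_lintegral_children hx (f := fun _ => 1) (u := u)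
      (@measurable_const _ _ _ (otherInputs ξt e u) _) hr

lemma tsum_lintegral_mass_ne_top (h : IsTreeInput P ν ξt e) (hx : 0 < x) {r : ℝ} (hr : 0 < r)
    (hm : powerMoment ν r < 1) : ∑' u, ∫⁻ ω, mass x ξt r u ω ∂P ≠ ∞ := by
  rw [← tsum_genSum]
  simp only [h.genSum_lintegral_mass hx hr, ENNReal.tsum_mul_right, ENNReal.tsum_geometric]
  exact ENNReal.mul_ne_top (ENNReal.inv_ne_top.2 (tsub_pos_of_lt hm).ne') ENNReal.ofReal_ne_top

/-! ### Individuals of late generations are born late -/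

lemma lintegral_exp_neg_lt_one (h : IsTreeInput P ν ξt e) (u : Node) :
    ∫⁻ ω, ENNReal.ofReal (Real.exp (-e u ω)) ∂P < 1 := by
  have h1 : Measurable fun ω => ENNReal.ofReal (Real.exp (-e u ω)) :=
    (h.measurable_exp u).neg.exp.ennreal_ofReal
  have h2 : ∀ᵐ ω ∂P, ENNReal.ofReal (Real.exp (-e u ω)) < 1 := by
    filter_upwards [h.ae_goodInput] with ω hω
    rw [ENNReal.ofReal_lt_one, Real.exp_lt_one_iff]
    linarith [(hω u).2]
  have h3 : ∫⁻ ω, ENNReal.ofReal (Real.exp (-e u ω)) ∂P ≠ ∞ := by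
    refine ((lintegral_mono_ae (h2.mono fun ω hω => hω.le)).trans_lt ?_).ne
    simp
  simpa using lintegral_strict_mono (IsProbabilityMeasure.ne_zero P) aemeasurable_const h3 h2

/-- Let `r n` be the mean over generation `n`. Children are born at the death of their parent and
preserve the mean weight, so `exp_neg_lifetime_mul_mass_le` gives `r (n + 1) ≤ ρ * r n + k n` with
`ρ` the mean of `exp(-e)`, less than `1`, and `k n` the mean mass of order `q` of generation `n`,
which is summable. -/
lemma tsum_lintegral_exp_neg_birth_ne_top (h : IsTreeInput P ν ξt e) (hα : 0 ≤ α) (hx : 0 < x)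
    {p q : ℝ} (hp : 0 < p) (hpq : p ≤ q) (hmp : powerMoment ν p = 1) (hmq : powerMoment ν q < 1) :
    ∑' u, ∫⁻ ω, ENNReal.ofReal (Real.exp (-birth α x ξt e u ω)) * mass x ξt p u ω ∂P ≠ ∞ := by
  have hexp : ∀ u, Measurable fun ω => ENNReal.ofReal (Real.exp (-e u ω)) := fun u =>
    (h.measurable_exp u).neg.exp.ennreal_ofReal
  have hbm : ∀ u, Measurable fun ω =>
      ENNReal.ofReal (Real.exp (-birth α x ξt e u ω)) * mass x ξt p u ω := fun u =>
    (measurable_birth α x h.measurable_ratio h.measurable_exp u).neg.exp.ennreal_ofReal.mul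
      (measurable_mass h.measurable_ratio p u)
  have hg : Measurable fun b : ℝ => ENNReal.ofReal (Real.exp (-b)) := by fun_prop
  rw [← tsum_genSum]
  refine tsum_ne_top_of_le_mul_add (h.lintegral_exp_neg_lt_one [])
    (k := fun n => genSum n fun u => ∫⁻ ω, mass x ξt q u ω ∂P) ?_ ?_ fun n => ?_
  · simp [genSum_zero, mass, size, birth]
  · rw [tsum_genSum]
    exact h.tsum_lintegral_mass_ne_top hx (hp.trans_le hpq) hmq
  rw [genSum_succ, ← genSum_const_mul, ← genSum_add]
  refine genSum_mono fun u => ?_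
  have h1 := h.tsum_lintegral_children hx (u := u) (r := p)
    (f := fun ω => ENNReal.ofReal (Real.exp (-(birth α x ξt e u ω + lifetime α x ξt e u ω))))
    (hg.comp (Measurable.fun_add
      (measurable_otherInputs_birth (not_suffix_and_ne_self u))
      (measurable_otherInputs_lifetime (not_suffix_and_ne_self u)))) hp
  rw [hmp, one_mul] at h1
  have h2 : ∫⁻ ω, ENNReal.ofReal (Real.exp (-birth α x ξt e u ω)) * mass x ξt p u ω *
        ENNReal.ofReal (Real.exp (-e u ω)) ∂P =
      (∫⁻ ω, ENNReal.ofReal (Real.exp (-birth α x ξt e u ω)) * mass x ξt p u ω ∂P) *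
        ∫⁻ ω, ENNReal.ofReal (Real.exp (-e u ω)) ∂P := by
    refine lintegral_mul_eq_lintegral_mul_lintegral_of_independent_measurableSpace
      (otherInputs_le h.measurable_exp h.measurable_ratio u) (h.measurable_exp u).comap_le
      (h.indep_exp u) ?_ (hg.comp (comap_measurable _))
    exact Measurable.fun_mul
      (hg.comp (measurable_otherInputs_exp_birth u))
      ((measurable_ofReal_rpow p).comp (measurable_otherInputs_exp_size u u))
  calc _ = ∫⁻ ω, ENNReal.ofReal (Real.exp (-(birth α x ξt e u ω + lifetime α x ξt e u ω))) *
        mass x ξt p u ω ∂P := h1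
    _ ≤ ∫⁻ ω, (ENNReal.ofReal (Real.exp (-birth α x ξt e u ω)) * mass x ξt p u ω *
        ENNReal.ofReal (Real.exp (-e u ω)) + mass x ξt q u ω) ∂P :=
      lintegral_mono_ae (h.ae_goodInput.mono fun ω hω =>
        hω.exp_neg_lifetime_mul_mass_le hα hx hp hpq u)
    _ = _ := by
      rw [lintegral_add_left ((hbm u).fun_mul (hexp u)), h2, mul_comm, h.lintegral_exp_neg_eq u []]

end IsTreeInput

end Tree

/-! ### Tools for `L^p` bounds and the enumeration of nodes -/

lemma ofReal_abs_rpow {p : ℝ} (hp : 0 ≤ p) (y : ℝ) : ENNReal.ofReal (|y| ^ p) = ‖y‖ₑ ^ p := by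
  rw [Real.enorm_eq_ofReal_abs, ENNReal.ofReal_rpow_of_nonneg (abs_nonneg _) hp]

/-- A crude form of Young's inequality, needed only for the integrability of the cross term. -/
lemma abs_abs_rpow_mul_mul_le {p : ℝ} (hp : 1 < p) (a b : ℝ) :
    |(|a| ^ (p - 2) * a * b)| ≤ |a| ^ p + |b| ^ p := by
  have h1 : |(|a| ^ (p - 2) * a * b)| = |a| ^ (p - 1) * |b| := by
    rw [abs_mul, abs_mul, abs_of_nonneg (Real.rpow_nonneg (abs_nonneg a) _),
      ← abs_rpow_sub_two_mul (abs_nonneg a) hp, abs_abs]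
  have h2 : ∀ y : ℝ, 0 ≤ y → y ^ (p - 1) * y = y ^ p := fun y hy => by
    rcases hy.eq_or_lt with rfl | hy
    · simp [Real.zero_rpow (by linarith : p ≠ 0)]
    · rw [← Real.rpow_add_one hy.ne', sub_add_cancel]
  have ha : 0 ≤ |a| ^ p := Real.rpow_nonneg (abs_nonneg _) _
  have hb : 0 ≤ |b| ^ p := Real.rpow_nonneg (abs_nonneg _) _
  rw [h1]
  rcases le_total |b| |a| with h | h
  · calc _ ≤ |a| ^ (p - 1) * |a| := by gcongr
      _ ≤ _ := by rw [h2 _ (abs_nonneg a)]; linarith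
  · calc _ ≤ |b| ^ (p - 1) * |b| := by
          have := Real.rpow_le_rpow (abs_nonneg a) h (by linarith : 0 ≤ p - 1)
          gcongr
      _ ≤ _ := by rw [h2 _ (abs_nonneg b)]; linarith

/-- Fatou's lemma. -/
lemma lintegral_rpow_enorm_le_of_tendsto {Ω : Type*} [MeasurableSpace Ω] {P : Measure Ω}
    {f : ℕ → Ω → ℝ} {g : Ω → ℝ} {p : ℝ} {c : ℝ≥0∞} (hf : ∀ n, AEMeasurable (f n) P)
    (hfg : ∀ᵐ ω ∂P, Tendsto (fun n => f n ω) atTop (𝓝 (g ω)))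
    (hc : ∀ n, ∫⁻ ω, ‖f n ω‖ₑ ^ p ∂P ≤ c) : ∫⁻ ω, ‖g ω‖ₑ ^ p ∂P ≤ c := by
  have h1 : ∫⁻ ω, ‖g ω‖ₑ ^ p ∂P = ∫⁻ ω, liminf (fun n => ‖f n ω‖ₑ ^ p) atTop ∂P := by
    refine lintegral_congr_ae (hfg.mono fun ω hω => ?_)
    exact (((ENNReal.continuous_rpow_const.tendsto _).comp hω.enorm).liminf_eq).symm
  rw [h1]
  refine (lintegral_liminf_le' fun n => (hf n).enorm.pow_const p).trans ?_
  exact liminf_le_of_le (by isBoundedDefault) fun b hb => by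
    obtain ⟨n, hn⟩ := hb.exists
    exact hn.trans (hc n)

/-- The encoding lists ancestors before descendants. Taken in this order, the increments form a
sequence of martingale differences. -/
lemma encode_le_of_suffix {u v : Node} (h : u <:+ v) : Encodable.encode u ≤ Encodable.encode v := by
  induction v with
  | nil => rw [List.suffix_nil.1 h]
  | cons i v ih =>
    rcases List.suffix_cons_iff.1 h with rfl | h
    · exact le_rfl
    · refine (ih h).trans ?_
      rw [Encodable.encode_list_cons]
      exact (Nat.right_le_pair _ _).trans (Nat.le_succ _)

/-! ### The increments of the intrinsic martingale -/

/-- The excess over `1` of the sum of the `r`-th powers of a sequence. -/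
noncomputable def excess (r : ℝ) (s : ℕ → ℝ) : ℝ := (powerSum r s).toReal - 1

lemma measurable_excess (r : ℝ) : Measurable (excess r) :=
  (measurable_powerSum r).ennreal_toReal.sub_const 1

/-- The absolute moment of order `p` of the excess under the reproduction law. -/
noncomputable def excessMoment (ν : Measure PointMeasure) (r p : ℝ) : ℝ≥0∞ :=
  ∫⁻ s, ‖(∫⁻ y, ENNReal.ofReal (y ^ r) ∂s.1).toReal - 1‖ₑ ^ p ∂ν

lemma excessMoment_ne_top {ν : Measure PointMeasure} [IsProbabilityMeasure ν] {r p : ℝ}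
    (hp : 1 ≤ p) (h : ∫⁻ s, (∫⁻ y, ENNReal.ofReal (y ^ r) ∂s.1) ^ p ∂ν < ∞) :
    excessMoment ν r p ≠ ∞ := by
  have h1 : ∀ y : ℝ≥0∞, ‖y.toReal - 1‖ₑ ^ p ≤ 2 ^ (p - 1) * (y ^ p + 1) := fun y => by
    calc ‖y.toReal - 1‖ₑ ^ p ≤ (y + 1) ^ p := by
          gcongr
          refine enorm_sub_le.trans ?_
          rw [Real.enorm_of_nonneg ENNReal.toReal_nonneg, enorm_one]
          gcongr
          exact ENNReal.ofReal_toReal_le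
      _ ≤ _ := by simpa using ENNReal.rpow_add_le_mul_rpow_add_rpow y 1 hp
  refine ((lintegral_mono fun s => h1 _).trans_lt ?_).ne
  rw [lintegral_const_mul _ (((measurable_lintegral_rpow r).pow_const p).add_const 1),
    lintegral_add_right _ measurable_const]
  refine ENNReal.mul_lt_top (by simp [ENNReal.rpow_lt_top_of_nonneg (sub_nonneg.2 hp)]) ?_
  simpa using h

section Increment

variable {Ω : Type*} {α x : ℝ} {ξt : Node → Ω → ℕ → ℝ} {e : Node → Ω → ℝ}

/-- The contribution to the intrinsic martingale of the replacement of an individual by its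
children. -/
noncomputable def increment (x : ℝ) (ξt : Node → Ω → ℕ → ℝ) (r : ℝ) (u : Node) (ω : Ω) : ℝ :=
  size x ξt u ω ^ r * excess r (ξt u ω)

/-- The event `E u` depends only on the lifetimes, and on the offspring of nodes which are strict
ancestors of `u`. -/
def IsPredictable (ξt : Node → Ω → ℕ → ℝ) (e : Node → Ω → ℝ) (E : Node → Set Ω) : Prop :=
  ∀ u v, ¬(v <:+ u ∧ v ≠ u) → MeasurableSet[otherInputs ξt e v] (E u)

/-- A node listed before `v` is neither `v` nor one of its descendants, so its increment does not
involve the offspring of `v`. -/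
lemma IsPredictable.measurable_indicator_increment {E : Node → Set Ω}
    (hE : IsPredictable ξt e E) (r : ℝ) {u v : Node} (h : Encodable.encode u < Encodable.encode v) :
    Measurable[otherInputs ξt e v] ((E u).indicator (increment x ξt r u)) := by
  have h1 : ¬(v <:+ u ∧ v ≠ u) := fun h1 => absurd (encode_le_of_suffix h1.1) (not_le.2 h)
  have h2 : u ≠ v := by rintro rfl; exact h.false
  have h3 : Measurable[otherInputs ξt e v] (ξt u) := by
    have := measurable_otherInputs_update (f := ξt) (g := e) v u
    rwa [Function.update_of_ne h2] at this
  refine Measurable.indicator ?_ (hE u v h1)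
  exact Measurable.fun_mul ((measurable_id.pow_const r).comp (measurable_otherInputs_size h1))
    ((measurable_excess r).comp h3)

variable [MeasurableSpace Ω] {P : Measure Ω} {ν : Measure PointMeasure}

lemma measurable_increment (h : ∀ u, Measurable (ξt u)) (r : ℝ) (u : Node) :
    Measurable (increment x ξt r u) :=
  ((measurable_size x h u).pow_const r).mul ((measurable_excess r).comp (h u))

namespace IsTreeInput

lemma lintegral_excess (h : IsTreeInput P ν ξt e) {r : ℝ} (hr : 0 < r) (p : ℝ) (u : Node) :
    ∫⁻ ω, ‖excess r (ξt u ω)‖ₑ ^ p ∂P = excessMoment ν r p :=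
  lintegral_comp_powerSum (h.measurable_ratio u) (h.law_ratio u) hr
    (Φ := fun y => ‖y.toReal - 1‖ₑ ^ p)
    ((ENNReal.measurable_toReal.sub_const 1).enorm.pow_const p)

lemma measurable_indicator_increment (h : IsTreeInput P ν ξt e) (r : ℝ) {E : Node → Set Ω}
    (hE : IsPredictable ξt e E) (u : Node) : Measurable ((E u).indicator (increment x ξt r u)) :=
  (measurable_increment h.measurable_ratio r u).indicator
    (otherInputs_le h.measurable_ratio h.measurable_exp u _ (hE u u (not_suffix_and_ne_self u)))

variable [IsProbabilityMeasure P]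

lemma integral_excess (h : IsTreeInput P ν ξt e) {r : ℝ} (hr : 0 < r)
    (hm : powerMoment ν r = 1) (u : Node) : ∫ ω, excess r (ξt u ω) ∂P = 0 := by
  have h1 := h.lintegral_powerSum u hr
  have hmeas : AEMeasurable (fun ω => powerSum r (ξt u ω)) P :=
    ((measurable_powerSum r).comp (h.measurable_ratio u)).aemeasurable
  have h2 : ∫⁻ ω, powerSum r (ξt u ω) ∂P ≠ ∞ := by rw [h1, hm]; exact ENNReal.one_ne_top
  simp only [excess]
  rw [integral_sub (integrable_toReal_of_lintegral_ne_top hmeas h2) (integrable_const _),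
    integral_toReal hmeas (ae_lt_top' hmeas h2), h1, hm]
  simp

lemma integral_mul_excess (h : IsTreeInput P ν ξt e) {r : ℝ} (hr : 0 < r)
    (hm : powerMoment ν r = 1) {u : Node} {f : Ω → ℝ}
    (hf : Measurable[otherInputs ξt e u] f) : ∫ ω, f ω * excess r (ξt u ω) ∂P = 0 := by
  have h1 : IndepFun f (fun ω => excess r (ξt u ω)) P := by
    rw [IndepFun_iff_Indep]
    refine indep_of_indep_of_le (h.indep_ratio u) hf.comap_le ?_
    exact ((measurable_excess r).comp (comap_measurable (ξt u))).comap_le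
  rw [h1.integral_fun_mul_eq_mul_integral
    (hf.mono (otherInputs_le h.measurable_ratio h.measurable_exp u) le_rfl).aestronglyMeasurable
    ((measurable_excess r).comp (h.measurable_ratio u)).aestronglyMeasurable,
    h.integral_excess hr hm, mul_zero]

lemma lintegral_indicator_increment (h : IsTreeInput P ν ξt e) (hx : 0 < x) {r : ℝ} (hr : 0 < r)
    {p : ℝ} (hp : 0 < p) {u : Node} {E : Set Ω} (hE : MeasurableSet[otherInputs ξt e u] E) :
    ∫⁻ ω, ‖E.indicator (increment x ξt r u) ω‖ₑ ^ p ∂P =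
      (∫⁻ ω, E.indicator (mass x ξt (p * r) u) ω ∂P) * excessMoment ν r p := by
  rw [← h.lintegral_excess hr p u, ← h.lintegral_mul_comp_ratio
    ((measurable_otherInputs_mass (not_suffix_and_ne_self u) _).indicator hE)
    ((measurable_excess r).enorm.pow_const p)]
  refine lintegral_congr_ae (h.ae_goodInput.mono fun ω hω => ?_)
  by_cases hωE : ω ∈ E
  · have hs := hω.size_nonneg hx u
    simp only [Set.indicator_of_mem hωE, increment, enorm_mul, mass]
    rw [ENNReal.mul_rpow_of_nonneg _ _ hp.le, Real.enorm_of_nonneg (Real.rpow_nonneg hs r),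
      ENNReal.ofReal_rpow_of_nonneg (Real.rpow_nonneg hs r) hp.le, ← Real.rpow_mul hs, mul_comm p]
  · simp [hωE, ENNReal.zero_rpow_of_pos hp]

lemma integrable_abs_indicator_increment (h : IsTreeInput P ν ξt e) (hx : 0 < x) {r : ℝ}
    (hr : 0 < r) {p : ℝ} (hp : 1 < p) (hmq : powerMoment ν (p * r) < 1)
    (hK : excessMoment ν r p ≠ ∞) {E : Node → Set Ω} (hE : IsPredictable ξt e E) (u : Node) :
    Integrable (fun ω => |(E u).indicator (increment x ξt r u) ω| ^ p) P := by
  have hmeas := (h.measurable_indicator_increment (x := x) r hE u)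
  refine ⟨(hmeas.abs.pow_const p).aestronglyMeasurable, ?_⟩
  rw [hasFiniteIntegral_iff_ofReal (ae_of_all _ fun ω => Real.rpow_nonneg (abs_nonneg _) _)]
  simp only [ofReal_abs_rpow (by linarith : 0 ≤ p)]
  rw [h.lintegral_indicator_increment hx hr (by linarith) (hE u u (not_suffix_and_ne_self u))]
  refine ENNReal.mul_lt_top ?_ hK.lt_top
  refine (lintegral_mono fun ω => Set.indicator_le_self _ _ _).trans_lt ?_
  refine (ENNReal.le_tsum u).trans_lt (h.tsum_lintegral_mass_ne_top hx (r := p * r) ?_ hmq).lt_top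
  positivity

/-- The von Bahr–Esseen bound for finite sums of increments. -/
lemma integral_abs_sum_increment_rpow_le (h : IsTreeInput P ν ξt e) (hx : 0 < x) {r : ℝ}
    (hr : 0 < r) {p : ℝ} (hp1 : 1 < p) (hp2 : p ≤ 2) (hm : powerMoment ν r = 1)
    (hmq : powerMoment ν (p * r) < 1) (hK : excessMoment ν r p ≠ ∞) {E : Node → Set Ω}
    (hE : IsPredictable ξt e E) (F : Finset Node) :
    Integrable (fun ω => |∑ u ∈ F, (E u).indicator (increment x ξt r u) ω| ^ p) P ∧
      ∫ ω, |∑ u ∈ F, (E u).indicator (increment x ξt r u) ω| ^ p ∂P ≤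
        2 * p * ∑ u ∈ F, ∫ ω, |(E u).indicator (increment x ξt r u) ω| ^ p ∂P := by
  classical
  -- Nodes are added in the order of the encoding, so that the sum `S` over the previous nodes does
  -- not involve the offspring of the new node `a`.
  induction F using Finset.induction_on_max_value (fun u : Node => Encodable.encode u) with
  | empty => simp [Real.zero_rpow (by linarith : p ≠ 0)]
  | insert a s ha hmax ih =>
    obtain ⟨ihi, ihb⟩ := ih
    have hb := h.integrable_abs_indicator_increment hx hr hp1 hmq hK hE a
    set b := (E a).indicator (increment x ξt r a) with hb_def
    set S : Ω → ℝ := fun ω => ∑ u ∈ s, (E u).indicator (increment x ξt r u) ω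
    have hbm : Measurable b := h.measurable_indicator_increment r hE a
    have hSm : Measurable S := Finset.measurable_fun_sum _ fun u _ =>
      h.measurable_indicator_increment r hE u
    have hSa : Measurable[otherInputs ξt e a] S :=
      Finset.measurable_fun_sum _ fun u hu => hE.measurable_indicator_increment r
        (lt_of_le_of_ne (hmax u hu) fun heq => ha (Encodable.encode_injective heq ▸ hu))
    -- The factor multiplying the excess of `a` depends on the other inputs only, and the excess is
    -- centred.
    have hcross : ∫ ω, |S ω| ^ (p - 2) * S ω * b ω ∂P = 0 := by
      have h1 : Measurable[otherInputs ξt e a] fun ω =>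
          |S ω| ^ (p - 2) * S ω * (E a).indicator (fun ω => size x ξt a ω ^ r) ω := by
        have hg : Measurable fun y : ℝ => |y| ^ (p - 2) * y := by fun_prop
        exact Measurable.fun_mul (hg.comp hSa) (Measurable.indicator
          ((measurable_id.pow_const r).comp
            (measurable_otherInputs_size (not_suffix_and_ne_self a)))
          (hE a a (not_suffix_and_ne_self a)))
      rw [← h.integral_mul_excess hr hm h1]
      congr 1
      funext ω
      rw [hb_def]
      by_cases hω : ω ∈ E a <;> simp [hω, increment, mul_assoc]
    have hcrossi : Integrable (fun ω => |S ω| ^ (p - 2) * S ω * b ω) P :=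
      (ihi.add hb).mono' (by fun_prop) (ae_of_all _ fun ω => abs_abs_rpow_mul_mul_le hp1 _ _)
    have hpt : ∀ ω, |∑ u ∈ insert a s, (E u).indicator (increment x ξt r u) ω| ^ p ≤
        |S ω| ^ p + p * (|S ω| ^ (p - 2) * S ω * b ω) + 2 * p * |b ω| ^ p := fun ω => by
      rw [Finset.sum_insert ha, add_comm]
      exact abs_add_rpow_le hp1 hp2 _ _
    have hi : Integrable (fun ω => |S ω| ^ p + p * (|S ω| ^ (p - 2) * S ω * b ω) +
        2 * p * |b ω| ^ p) P := (ihi.add (hcrossi.const_mul p)).add (hb.const_mul _)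
    have hi' : Integrable
        (fun ω => |∑ u ∈ insert a s, (E u).indicator (increment x ξt r u) ω| ^ p) P := by
      refine hi.mono' (Measurable.aestronglyMeasurable ?_) (ae_of_all _ fun ω => ?_)
      · exact (Finset.measurable_fun_sum _ fun u _ =>
          h.measurable_indicator_increment r hE u).abs.pow_const p
      · rw [Real.norm_of_nonneg (Real.rpow_nonneg (abs_nonneg _) _)]
        exact hpt ω
    refine ⟨hi', (integral_mono hi' hi hpt).trans ?_⟩
    have ihi' : Integrable (fun ω => |S ω| ^ p) P := ihi
    have ihb' : ∫ ω, |S ω| ^ p ∂P ≤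
      2 * p * ∑ u ∈ s, ∫ ω, |(E u).indicator (increment x ξt r u) ω| ^ p ∂P := ihb
    have hi₁ : Integrable (fun ω => |S ω| ^ p + p * (|S ω| ^ (p - 2) * S ω * b ω)) P :=
      ihi'.add (hcrossi.const_mul p)
    rw [integral_add hi₁ (hb.const_mul _),
      integral_add ihi' (hcrossi.const_mul p), integral_const_mul, integral_const_mul, hcross,
      Finset.sum_insert ha]
    linarith

/-- The von Bahr–Esseen bound for sums of increments. -/
lemma lintegral_tsum_increment_rpow_le (h : IsTreeInput P ν ξt e) (hx : 0 < x) {r : ℝ}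
    (hr : 0 < r) {p : ℝ} (hp1 : 1 < p) (hp2 : p ≤ 2) (hm : powerMoment ν r = 1)
    (hmq : powerMoment ν (p * r) < 1) (hK : excessMoment ν r p ≠ ∞) {E : Node → Set Ω}
    (hE : IsPredictable ξt e E)
    (hs : ∀ᵐ ω ∂P, Summable fun u => (E u).indicator (increment x ξt r u) ω) :
    ∫⁻ ω, ‖∑' u, (E u).indicator (increment x ξt r u) ω‖ₑ ^ p ∂P ≤
      ENNReal.ofReal (2 * p) * excessMoment ν r p *
        ∑' u, ∫⁻ ω, (E u).indicator (mass x ξt (p * r) u) ω ∂P := by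
  have hfin : ∀ F : Finset Node,
      ∫⁻ ω, ‖∑ u ∈ F, (E u).indicator (increment x ξt r u) ω‖ₑ ^ p ∂P ≤
        ENNReal.ofReal (2 * p) * excessMoment ν r p *
          ∑' u, ∫⁻ ω, (E u).indicator (mass x ξt (p * r) u) ω ∂P := fun F => by
    obtain ⟨hi, hb⟩ := h.integral_abs_sum_increment_rpow_le hx hr hp1 hp2 hm hmq hK hE F
    have h0 : 0 ≤ p := by linarith
    have h1 : ∀ f : Ω → ℝ, Integrable (fun ω => |f ω| ^ p) P →
        ENNReal.ofReal (∫ ω, |f ω| ^ p ∂P) = ∫⁻ ω, ‖f ω‖ₑ ^ p ∂P := fun f hf => by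
      rw [ofReal_integral_eq_lintegral_ofReal hf
        (ae_of_all _ fun ω => Real.rpow_nonneg (abs_nonneg _) _)]
      simp only [ofReal_abs_rpow h0]
    rw [← h1 _ hi]
    refine (ENNReal.ofReal_le_ofReal hb).trans ?_
    rw [ENNReal.ofReal_mul (by linarith), ENNReal.ofReal_sum_of_nonneg fun u _ =>
      integral_nonneg fun ω => Real.rpow_nonneg (abs_nonneg _) _, mul_assoc,
      ← ENNReal.tsum_mul_left]
    gcongr
    refine le_trans (le_of_eq ?_) (ENNReal.sum_le_tsum F)
    refine Finset.sum_congr rfl fun u _ => ?_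
    rw [h1 _ (h.integrable_abs_indicator_increment hx hr hp1 hmq hK hE u),
      h.lintegral_indicator_increment hx hr (by linarith) (hE u u (not_suffix_and_ne_self u)),
      mul_comm]
  -- The bound does not depend on the finite set `F`, so it passes to the limit along an enumeration
  -- of the nodes.
  refine lintegral_rpow_enorm_le_of_tendsto (f := fun n ω => ∑ u ∈ (Finset.range n).map
    (Denumerable.eqv Node).symm.toEmbedding, (E u).indicator (increment x ξt r u) ω)
    (fun n => (Finset.measurable_fun_sum _ fun u _ =>
      h.measurable_indicator_increment r hE u).aemeasurable)
    (hs.mono fun ω hω => ?_) fun n => hfin _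
  simp only [Finset.sum_map]
  exact ((Equiv.hasSum_iff (Denumerable.eqv Node).symm).2 hω.hasSum).tendsto_sum_nat

end IsTreeInput

end Increment

/-! ### Telescoping sums along the tree -/

/-- The nodes whose parent belongs to `S`. -/
def childrenOf (S : Set Node) : Set Node := {v | ∃ i, ∃ u ∈ S, v = i :: u}

lemma nil_notMem_childrenOf (S : Set Node) : ([] : Node) ∉ childrenOf S := by
  rintro ⟨i, u, -, h⟩
  exact absurd h (by simp)

lemma cons_mem_childrenOf {S : Set Node} {i : ℕ} {u : Node} : i :: u ∈ childrenOf S ↔ u ∈ S := by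
  constructor
  · rintro ⟨j, v, hv, h⟩
    simp only [List.cons.injEq] at h
    exact h.2 ▸ hv
  · exact fun h => ⟨i, u, h, rfl⟩

section Telescope

variable {Ω : Type*} {α x r : ℝ} {ξt : Node → Ω → ℕ → ℝ} {e : Node → Ω → ℝ} {ω : Ω}

/-- The `r`-th power of the size of an individual. -/
noncomputable def weight (x : ℝ) (ξt : Node → Ω → ℕ → ℝ) (r : ℝ) (ω : Ω) (u : Node) : ℝ :=
  size x ξt u ω ^ r

/-- The inputs are in their range, and all the sums over the tree which occur below converge. -/
structure RegularInput (α x r : ℝ) (ξt : Node → Ω → ℕ → ℝ) (e : Node → Ω → ℝ) (ω : Ω) :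
    Prop where
  good : GoodInput ξt e ω
  powerSum_ne_top : ∀ u, powerSum r (ξt u ω) ≠ ∞
  summable_gen : ∀ n, Summable ({u : Node | u.length < n}.indicator (weight x ξt r ω))
  summable_birth : Summable fun u => Real.exp (-birth α x ξt e u ω) * weight x ξt r ω u

lemma GoodInput.weight_nonneg (h : GoodInput ξt e ω) (hx : 0 < x) (u : Node) :
    0 ≤ weight x ξt r ω u :=
  Real.rpow_nonneg (h.size_nonneg hx u) r

namespace RegularInput

lemma summable_indicator (h : RegularInput α x r ξt e ω) (hx : 0 < x) {n : ℕ}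
    {S : Set Node} (hS : ∀ u ∈ S, u.length < n) :
    Summable (S.indicator (weight x ξt r ω)) :=
  (h.summable_gen n).of_nonneg_of_le
    (fun u => Set.indicator_nonneg (fun u _ => h.good.weight_nonneg hx u) u)
    fun u => Set.indicator_le_indicator_of_subset hS (fun u => h.good.weight_nonneg hx u) u

lemma tsum_weight_children (h : RegularInput α x r ξt e ω) (hx : 0 < x) (u : Node) :
    ∑' i, weight x ξt r ω (i :: u) = weight x ξt r ω u + increment x ξt r u ω := by
  have h1 : ∀ i, weight x ξt r ω (i :: u) = weight x ξt r ω u * ξt u ω i ^ r := fun i => by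
    rw [weight, weight, size, Real.mul_rpow ((h.good u).1 i) (h.good.size_nonneg hx u), mul_comm]
  simp only [h1]
  rw [tsum_mul_left, increment, excess, powerSum, ENNReal.tsum_toReal_eq (by simp)]
  simp only [ENNReal.toReal_ofReal (Real.rpow_nonneg ((h.good u).1 _) r), weight]
  ring

/-- The weights of the children are regrouped by parent. The limit is written as a single sum
because `S` and `childrenOf S` may overlap, and the cancellation is then performed node by node. -/
lemma hasSum_increment (h : RegularInput α x r ξt e ω) (hx : 0 < x) {n : ℕ}
    {S : Set Node} (hS : ∀ u ∈ S, u.length < n) :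
    HasSum (S.indicator fun u => increment x ξt r u ω)
      (∑' v, ((childrenOf S).indicator (weight x ξt r ω) v - S.indicator (weight x ξt r ω) v)) := by
  have hS' : ∀ v ∈ childrenOf S, v.length < n + 1 := by
    rintro _ ⟨i, u, hu, rfl⟩
    simpa using hS u hu
  have h1 := h.summable_indicator hx hS
  have h2 := h.summable_indicator hx hS'
  have h0 : (childrenOf S).indicator (weight x ξt r ω) [] = 0 :=
    Set.indicator_of_notMem (nil_notMem_childrenOf S) _
  have h3 : ∀ u, ∑' i, (childrenOf S).indicator (weight x ξt r ω) (i :: u) =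
      S.indicator (weight x ξt r ω) u + S.indicator (fun u => increment x ξt r u ω) u := by
    intro u
    by_cases hu : u ∈ S
    · simp only [Set.indicator_of_mem (cons_mem_childrenOf.2 hu), Set.indicator_of_mem hu,
        h.tsum_weight_children hx]
    · simp [Set.indicator, cons_mem_childrenOf, hu]
  have h4 := (h2.comp_injective cons_uncurry_injective).prod
  simp only [Function.comp_def, h3] at h4
  have h5 : Summable (S.indicator fun u => increment x ξt r u ω) := by
    simpa using h4.sub h1
  rw [h2.tsum_sub h1, tsum_node_eq_tsum_cons_real h0 h2]
  simp only [h3]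
  rw [h1.tsum_add h5, add_sub_cancel_left]
  exact h5.hasSum

lemma genM_eq_tsum (n : ℕ) :
    genM x ξt r n ω = ∑' u, {u : Node | u.length = n}.indicator (weight x ξt r ω) u :=
  tsum_subtype {u : Node | u.length = n} (weight x ξt r ω)

lemma genM_zero : genM x ξt r 0 ω = x ^ r := by
  rw [genM_eq_tsum, tsum_eq_single []]
  · simp [weight, size]
  · intro u hu
    simp [hu]

lemma hasSum_genM_succ_sub (h : RegularInput α x r ξt e ω) (hx : 0 < x) (n : ℕ) :
    HasSum ({u : Node | u.length = n}.indicator fun u => increment x ξt r u ω)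
      (genM x ξt r (n + 1) ω - genM x ξt r n ω) := by
  have h1 := h.hasSum_increment hx (n := n + 1) (S := {u : Node | u.length = n})
    (fun u hu => by simp only [Set.mem_ofPred_eq] at hu; omega)
  have h2 : childrenOf {u : Node | u.length = n} = {u : Node | u.length = n + 1} := by
    ext v
    rcases v with _ | ⟨i, v⟩
    · simp [nil_notMem_childrenOf]
    · simp [cons_mem_childrenOf]
  rwa [h2, Summable.tsum_sub
    (h.summable_indicator hx (n := n + 2) fun u hu => by simp only [Set.mem_ofPred_eq] at hu; omega)
    (h.summable_indicator hx (n := n + 1) fun u hu => by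
      simp only [Set.mem_ofPred_eq] at hu; omega),
    ← genM_eq_tsum, ← genM_eq_tsum] at h1

end RegularInput

/-- The individuals of generation less than `n` which are alive at time `t`, and those of
generation `n` which are born before time `t`. -/
def line (α x : ℝ) (ξt : Node → Ω → ℕ → ℝ) (e : Node → Ω → ℝ) (t : ℝ≥0) (n : ℕ) (ω : Ω) :
    Set Node :=
  {u | (u.length < n ∧ Alive α x ξt e t u ω) ∨ (u.length = n ∧ birth α x ξt e u ω ≤ t)}

/-- The sum of the weights of the individuals in `line`. -/
noncomputable def lineSum (α x r : ℝ) (ξt : Node → Ω → ℕ → ℝ) (e : Node → Ω → ℝ) (t : ℝ≥0)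
    (n : ℕ) (ω : Ω) : ℝ :=
  ∑' u, (line α x ξt e t n ω).indicator (weight x ξt r ω) u

/-- No integrability is needed: if the sum is infinite, both sides take the default value `0`. -/
lemma M_eq_toReal (t : ℝ≥0) (ω : Ω) :
    M α x ξt e r t ω = (∫⁻ y, ENNReal.ofReal (y ^ r) ∂(X α x ξt e t ω)).toReal := by
  classical
  refine pairing_rpow_eq_toReal ?_ r
  rw [X, Measure.ae_sum_iff]
  intro u
  split_ifs with hu
  · rw [ae_dirac_eq]
    exact hu.1
  · simp

lemma lintegral_X (t : ℝ≥0) (ω : Ω) : ∫⁻ y, ENNReal.ofReal (y ^ r) ∂(X α x ξt e t ω) =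
    ∑' u, {u | Alive α x ξt e t u ω}.indicator (fun u => mass x ξt r u ω) u := by
  classical
  rw [X, lintegral_sum_measure]
  refine tsum_congr fun u => ?_
  by_cases hu : Alive α x ξt e t u ω
  · rw [if_pos hu, lintegral_dirac' _ (measurable_ofReal_rpow r)]
    simp [hu, mass]
  · simp [hu]

lemma GoodInput.toReal_tsum_indicator_mass (h : GoodInput ξt e ω) (hx : 0 < x) (S : Set Node) :
    (∑' u, S.indicator (fun u => mass x ξt r u ω) u).toReal =
      ∑' u, S.indicator (weight x ξt r ω) u := by
  rw [ENNReal.tsum_toReal_eq fun u => by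
    by_cases hu : u ∈ S <;> simp [hu, mass]]
  refine tsum_congr fun u => ?_
  by_cases hu : u ∈ S
  · rw [Set.indicator_of_mem hu, Set.indicator_of_mem hu]
    exact ENNReal.toReal_ofReal (h.weight_nonneg hx u)
  · simp [hu]

lemma GoodInput.M_eq_tsum (h : GoodInput ξt e ω) (hx : 0 < x) (t : ℝ≥0) :
    M α x ξt e r t ω = ∑' u, {u | Alive α x ξt e t u ω}.indicator (weight x ξt r ω) u := by
  rw [M_eq_toReal, lintegral_X, h.toReal_tsum_indicator_mass hx]

/-- Chernoff's bound for the indicator of `a_u ≤ t`; it provides a summable majorant independent of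
`S`. -/
lemma GoodInput.indicator_weight_le (h : GoodInput ξt e ω) (hx : 0 < x) {t : ℝ≥0} {S : Set Node}
    (hS : ∀ u ∈ S, birth α x ξt e u ω ≤ t) (u : Node) : S.indicator (weight x ξt r ω) u ≤
      Real.exp t * (Real.exp (-birth α x ξt e u ω) * weight x ξt r ω u) := by
  have hw := h.weight_nonneg hx u (r := r)
  by_cases hu : u ∈ S
  · rw [Set.indicator_of_mem hu, ← mul_assoc, ← Real.exp_add]
    refine le_mul_of_one_le_left hw (Real.one_le_exp ?_)
    linarith [hS u hu]
  · rw [Set.indicator_of_notMem hu]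
    positivity

lemma birth_le_of_mem_line {t : ℝ≥0} {n : ℕ} : ∀ u ∈ line α x ξt e t n ω,
    birth α x ξt e u ω ≤ t := by
  rintro u (⟨-, hu⟩ | ⟨-, hu⟩)
  · exact hu.2.1
  · exact hu

namespace RegularInput

/-- A fixed `u` belongs to `line` for `n > |u|` exactly when it is alive, so the contribution of
generation `n` disappears by dominated convergence. -/
lemma tendsto_lineSum (h : RegularInput α x r ξt e ω) (hx : 0 < x) (t : ℝ≥0) :
    Tendsto (fun n => lineSum α x r ξt e t n ω) atTop (𝓝 (M α x ξt e r t ω)) := by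
  rw [h.good.M_eq_tsum hx]
  refine tendsto_tsum_of_dominated_convergence (h.summable_birth.mul_left (Real.exp t))
    (fun u => ?_) (Eventually.of_forall fun n u => ?_)
  · refine tendsto_const_nhds.congr' ?_
    filter_upwards [eventually_gt_atTop u.length] with n hn
    have h1 : u ∈ line α x ξt e t n ω ↔ u ∈ {u | Alive α x ξt e t u ω} := by
      simp [line, hn, hn.ne]
    by_cases hu : u ∈ {u | Alive α x ξt e t u ω}
    · rw [Set.indicator_of_mem hu, Set.indicator_of_mem (h1.2 hu)]
    · rw [Set.indicator_of_notMem hu, Set.indicator_of_notMem (h1.not.2 hu)]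
  · rw [Real.norm_of_nonneg (Set.indicator_nonneg (fun u _ => h.good.weight_nonneg hx u) u)]
    exact h.good.indicator_weight_le hx birth_le_of_mem_line u

lemma abs_lineSum_le (h : RegularInput α x r ξt e ω) (hx : 0 < x) (t : ℝ≥0) (n : ℕ) :
    |lineSum α x r ξt e t n ω| ≤
    Real.exp t * ∑' u, Real.exp (-birth α x ξt e u ω) * weight x ξt r ω u := by
  have h0 : ∀ u, 0 ≤ (line α x ξt e t n ω).indicator (weight x ξt r ω) u := fun u =>
    Set.indicator_nonneg (fun u _ => h.good.weight_nonneg hx u) u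
  rw [lineSum, abs_of_nonneg (tsum_nonneg h0), ← tsum_mul_left]
  have h1 := h.good.indicator_weight_le (α := α) hx (birth_le_of_mem_line (t := t) (n := n))
    (r := r)
  exact Summable.tsum_le_tsum h1 ((h.summable_birth.mul_left _).of_nonneg_of_le h0 h1)
    (h.summable_birth.mul_left _)

/-- Telescoping over the set `S` of nodes of generation less than `n` that die after `t`. Its
children are the nodes of generation at most `n` born after `t`; those of generation less than `n`
also belong to `S` and cancel. What remains is generation `n` born after `t`, minus the individuals
of lower generation alive at `t`. -/
lemma hasSum_genM_sub_lineSum (h : RegularInput α x r ξt e ω) (hx : 0 < x) (hr : 0 < r)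
    (t : ℝ≥0) (n : ℕ) :
    HasSum ({u : Node | u.length < n ∧
        (t : ℝ) < birth α x ξt e u ω + lifetime α x ξt e u ω}.indicator
          fun u => increment x ξt r u ω)
      (genM x ξt r n ω - lineSum α x r ξt e t n ω) := by
  have h1 := h.hasSum_increment hx (n := n) (S := {u : Node | u.length < n ∧
        (t : ℝ) < birth α x ξt e u ω + lifetime α x ξt e u ω}) fun u hu => hu.1
  convert h1 using 1
  rw [RegularInput.genM_eq_tsum, lineSum, ← Summable.tsum_sub
    (h.summable_indicator hx (n := n + 1) fun u hu => by simp only [Set.mem_ofPred_eq] at hu; omega)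
    (h.summable_indicator hx (n := n + 1) fun u hu => by
      simp only [line, Set.mem_ofPred_eq] at hu; omega)]
  refine tsum_congr fun v => ?_
  classical
  -- Nodes of size `0` can lie in `S` without being alive, but their weight vanishes.
  by_cases hw : weight x ξt r ω v = 0
  · simp [Set.indicator, hw]
  have hs : 0 < size x ξt v ω := by
    refine (h.good.size_nonneg hx v).lt_of_ne fun h0 => hw ?_
    rw [weight, ← h0, Real.zero_rpow hr.ne']
  have hl := h.good.lifetime_nonneg (α := α) hx v
  have hA : Alive α x ξt e t v ω ↔ birth α x ξt e v ω ≤ t ∧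
      (t : ℝ) < birth α x ξt e v ω + lifetime α x ξt e v ω := by
    simp [Alive, hs]
  -- The birth of a child is the death of its parent. The root, which is nobody's child, is excluded
  -- on the right because it is born at time `0 ≤ t`.
  have hC : v ∈ childrenOf {u : Node | u.length < n ∧
      (t : ℝ) < birth α x ξt e u ω + lifetime α x ξt e u ω} ↔
      v.length ≤ n ∧ (t : ℝ) < birth α x ξt e v ω := by
    rcases v with _ | ⟨i, v⟩
    · simp [nil_notMem_childrenOf, birth]
    · simp [cons_mem_childrenOf, birth]
  simp only [Set.indicator_apply, hC, line, Set.mem_ofPred_eq, hA]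
  rcases lt_trichotomy v.length n with h2 | h2 | h2
  · rcases le_or_gt (birth α x ξt e v ω) t with h3 | h3
    · by_cases h4 : (t : ℝ) < birth α x ξt e v ω + lifetime α x ξt e v ω <;>
        simp [h2, h2.ne, h3, h4, not_lt.2 h3]
    · have h4 : (t : ℝ) < birth α x ξt e v ω + lifetime α x ξt e v ω := by linarith
      simp [h2, h2.ne, h3, h4, not_le.2 h3, h2.le]
  · rcases le_or_gt (birth α x ξt e v ω) t with h3 | h3
    · simp [h2, h3, not_lt.2 h3]
    · simp [h2, h3, not_le.2 h3]
  · simp [h2.ne', not_lt.2 h2.le, not_le.2 h2]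

lemma hasSum_genM_sub_rpow (h : RegularInput α x r ξt e ω) (hx : 0 < x) (n : ℕ) :
    HasSum ({u : Node | u.length < n}.indicator fun u => increment x ξt r u ω)
      (genM x ξt r n ω - x ^ r) := by
  induction n with
  | zero => simp [genM_zero]
  | succ n ih =>
    have h1 := ih.add (h.hasSum_genM_succ_sub hx n)
    rw [add_comm, sub_add_sub_cancel] at h1
    classical
    convert h1 using 1
    funext u
    rcases lt_trichotomy u.length n with h2 | h2 | h2
    · simp [h2, h2.ne, h2.le]
    · simp [h2]
    · simp [h2.ne', not_lt.2 h2.le, not_le.2 h2]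

end RegularInput

end Telescope

/-! ### Orthogonality of the increments to the past of the process -/

section Past

variable {Ω : Type*} {α x r : ℝ} {ξt : Node → Ω → ℕ → ℝ} {e : Node → Ω → ℝ}

/-- Strict descendants of `u` are born after `t`, so none is alive at time `s`; after the
overwriting they have size `0` and are never alive. All other nodes keep their size, birth time and
lifetime. -/
lemma GoodInput.X_eq_X_update {ω : Ω} (h : GoodInput ξt e ω) (hx : 0 < x) {s t : ℝ≥0} (hst : s ≤ t)
    {u : Node} (hu : (t : ℝ) < birth α x ξt e u ω + lifetime α x ξt e u ω) :
    X α x ξt e s ω = X α x (Function.update ξt u 0) e s ω := by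
  classical
  simp only [X]
  congr 1
  funext v
  by_cases huv : u <:+ v ∧ u ≠ v
  · have h1 : ¬ Alive α x ξt e s v ω := fun h1 => by
      have h2 := h.death_le_birth (α := α) hx huv.1 huv.2
      have h3 : (s : ℝ) ≤ t := by exact_mod_cast hst
      linarith [h1.2.1]
    have h2 : ¬ Alive α x (Function.update ξt u 0) e s v ω := fun h2 => by
      have := h2.1
      rw [size_update_eq_zero huv.1 huv.2] at this
      exact this.false
    rw [if_neg h1, if_neg h2]
  · have h1 : ∀ w, w <:+ v → w ≠ v → ξt w ω = Function.update ξt u 0 w ω := fun w hw hne => by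
      rw [Function.update_of_ne]
      rintro rfl
      exact huv ⟨hw, hne⟩
    have h2 : size x ξt v ω = size x (Function.update ξt u 0) v ω := size_congr h1
    have h3 : birth α x ξt e v ω = birth α x (Function.update ξt u 0) e v ω :=
      birth_congr h1 fun _ _ _ => rfl
    have h4 : Alive α x ξt e s v ω ↔ Alive α x (Function.update ξt u 0) e s v ω := by
      simp only [Alive, lifetime, h2, h3]
    by_cases h5 : Alive α x (Function.update ξt u 0) e s v ω
    · rw [if_pos h5, if_pos (h4.2 h5), h2]
    · rw [if_neg h5, if_neg (h4.not.2 h5)]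

/-- The individuals of generation less than `n` which die after time `t`. -/
def diesAfter (α x : ℝ) (ξt : Node → Ω → ℕ → ℝ) (e : Node → Ω → ℝ) (t : ℝ≥0) (n : ℕ) (u : Node) :
    Set Ω :=
  {ω | u.length < n ∧ (t : ℝ) < birth α x ξt e u ω + lifetime α x ξt e u ω}

lemma isPredictable_diesAfter (t : ℝ≥0) (n : ℕ) :
    IsPredictable ξt e (diesAfter α x ξt e t n) := fun _ _ h =>
  (MeasurableSet.const _).inter (measurableSet_lt measurable_const
    ((measurable_otherInputs_birth h).fun_add (measurable_otherInputs_lifetime h)))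

lemma isPredictable_const (A : Node → Prop) : IsPredictable ξt e fun u => {_ω | A u} :=
  fun _ _ _ => MeasurableSet.const _

variable [MeasurableSpace Ω]

/-- Before the death of `u`, the past of the process does not depend on the offspring of `u`. -/
lemma exists_otherInputs_inter_eq (hξ : ∀ u, Measurable (ξt u)) (he : ∀ u, Measurable (e u))
    (hx : 0 < x) (t : ℝ≥0) (u : Node) {A : Set Ω}
    (hA : MeasurableSet[natFiltration α x hξ he t] A) :
    ∃ B, MeasurableSet[otherInputs ξt e u] B ∧ ∀ ω, GoodInput ξt e ω →
      (t : ℝ) < birth α x ξt e u ω + lifetime α x ξt e u ω → (ω ∈ A ↔ ω ∈ B) := by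
  let T : Set Ω := {ω | GoodInput ξt e ω ∧
    (t : ℝ) < birth α x ξt e u ω + lifetime α x ξt e u ω}
  -- The sets whose trace on `T` is the trace of a set of `otherInputs` form a σ-algebra, so it
  -- suffices to treat the generators `X(s)`.
  have h1 : (natFiltration α x hξ he t : MeasurableSpace Ω) ≤
      ((otherInputs ξt e u).comap (Subtype.val : T → Ω)).map Subtype.val := by
    refine iSup₂_le fun s hs => ?_
    rw [MeasurableSpace.comap_le_iff_le_map, MeasurableSpace.map_comp,
      ← MeasurableSpace.comap_le_iff_le_map, ← measurable_iff_comap_le]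
    have h2 : X α x ξt e s ∘ (Subtype.val : T → Ω) =
        X α x (Function.update ξt u 0) e s ∘ Subtype.val :=
      funext fun ω => ω.2.1.X_eq_X_update hx hs ω.2.2
    rw [h2]
    exact (@measurable_X Ω α x _ _ (otherInputs ξt e u) (measurable_otherInputs_update u)
      (measurable_otherInputs_right u) s).comp (comap_measurable _)
  obtain ⟨B, hB, hAB⟩ := h1 A hA
  refine ⟨B, hB, fun ω h2 h3 => ?_⟩
  exact (Set.ext_iff.1 hAB ⟨ω, h2, h3⟩).symm

variable {P : Measure Ω} [IsProbabilityMeasure P] {ν : Measure PointMeasure}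

/-- On the event that `u` dies after `t`, `A` may be replaced by an event `B` that does not involve
the offspring of `u`. The integrand is then a function of the other inputs times a centred excess.
-/
lemma IsTreeInput.setIntegral_diesAfter_increment (h : IsTreeInput P ν ξt e) (hx : 0 < x)
    (hr : 0 < r) (hm : powerMoment ν r = 1) (t : ℝ≥0) (n : ℕ) (u : Node) {A : Set Ω}
    (hA : MeasurableSet[natFiltration α x h.measurable_ratio h.measurable_exp t] A) :
    ∫ ω in A, (diesAfter α x ξt e t n u).indicator (increment x ξt r u) ω ∂P = 0 := by
  obtain ⟨B, hB, hAB⟩ := exists_otherInputs_inter_eq h.measurable_ratio h.measurable_exp hx t u hA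
  have hD := isPredictable_diesAfter (α := α) (x := x) (ξt := ξt) (e := e) t n u u
    (not_suffix_and_ne_self u)
  have h1 : Measurable[otherInputs ξt e u]
      ((B ∩ diesAfter α x ξt e t n u).indicator fun ω => size x ξt u ω ^ r) :=
    Measurable.indicator ((measurable_id.pow_const r).comp
      (measurable_otherInputs_size (not_suffix_and_ne_self u))) (hB.inter hD)
  rw [← integral_indicator ((natFiltration α x h.measurable_ratio h.measurable_exp).le t A hA),
    ← h.integral_mul_excess hr hm h1]
  refine integral_congr_ae (h.ae_goodInput.mono fun ω hω => ?_)
  classical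
  by_cases hd : ω ∈ diesAfter α x ξt e t n u
  · have := hAB ω hω hd.2
    by_cases hωB : ω ∈ B
    · simp [hd, hωB, this.2 hωB, increment]
    · simp [hωB, this.not.2 hωB]
  · simp [Set.indicator_apply, hd]

end Past

lemma eLpNorm_ofReal_eq {Ω : Type*} [MeasurableSpace Ω] {P : Measure Ω} {p : ℝ} (hp : 0 < p)
    (f : Ω → ℝ) : eLpNorm f (ENNReal.ofReal p) P = (∫⁻ ω, ‖f ω‖ₑ ^ p ∂P) ^ (1 / p) := by
  rw [eLpNorm_eq_lintegral_rpow_enorm_toReal (by simpa using hp) ENNReal.ofReal_ne_top,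
    ENNReal.toReal_ofReal hp.le]

/-! ### Moment bounds and almost sure summability -/

section Convergence

variable {Ω : Type*} [MeasurableSpace Ω] {P : Measure Ω} {ν : Measure PointMeasure}
  {α x r p : ℝ} {ξt : Node → Ω → ℕ → ℝ} {e : Node → Ω → ℝ}

/-- The assumptions under which the intrinsic martingale converges in `L^p`: the moment of order
`r` is `1`, that of order `p * r` is less than `1`, and the offspring has a moment of order `p`. -/
structure IsLpInput (P : Measure Ω) (ν : Measure PointMeasure) (α x r p : ℝ)
    (ξt : Node → Ω → ℕ → ℝ) (e : Node → Ω → ℝ) : Prop where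
  input : IsTreeInput P ν ξt e
  nonneg_index : 0 ≤ α
  size_pos : 0 < x
  exponent_pos : 0 < r
  one_lt : 1 < p
  le_two : p ≤ 2
  moment_eq_one : powerMoment ν r = 1
  moment_lt_one : powerMoment ν (p * r) < 1
  excess_ne_top : excessMoment ν r p ≠ ∞

lemma aemeasurable_tsum_weight (h : IsTreeInput P ν ξt e) (hx : 0 < x) {S : Ω → Set Node}
    (hS : ∀ u, MeasurableSet {ω | u ∈ S ω}) :
    AEMeasurable (fun ω => ∑' u, (S ω).indicator (weight x ξt r ω) u) P := by
  have h1 : Measurable fun ω => ∑' u, (S ω).indicator (fun u => mass x ξt r u ω) u :=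
    Measurable.tsum fun u => (measurable_mass h.measurable_ratio r u).indicator (hS u)
  exact ⟨_, h1.ennreal_toReal, h.ae_goodInput.mono fun ω hω =>
    (hω.toReal_tsum_indicator_mass hx _).symm⟩

namespace IsLpInput

lemma aemeasurable_genM (h : IsLpInput P ν α x r p ξt e) (n : ℕ) :
    AEMeasurable (genM x ξt r n) P := by
  have := aemeasurable_tsum_weight (r := r) h.input h.size_pos
    (S := fun _ => {u : Node | u.length = n}) fun u => MeasurableSet.const _
  exact this.congr (ae_of_all _ fun ω => (RegularInput.genM_eq_tsum n).symm)

lemma aemeasurable_lineSum (h : IsLpInput P ν α x r p ξt e) (t : ℝ≥0) (n : ℕ) :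
    AEMeasurable (lineSum α x r ξt e t n) P :=
  aemeasurable_tsum_weight h.input h.size_pos fun u =>
    ((MeasurableSet.const _).inter (measurableSet_alive α x h.input.measurable_ratio
      h.input.measurable_exp t u)).union ((MeasurableSet.const _).inter
      (measurableSet_le (measurable_birth α x h.input.measurable_ratio h.input.measurable_exp u)
        measurable_const))

/-- The constant of the `L^p` bounds. -/
noncomputable def _root_.BranchingChain.lpConst (ν : Measure PointMeasure) (r p : ℝ) : ℝ≥0∞ :=
  ENNReal.ofReal (2 * p) * excessMoment ν r p

lemma lpConst_ne_top (h : IsLpInput P ν α x r p ξt e) : lpConst ν r p ≠ ∞ :=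
  ENNReal.mul_ne_top ENNReal.ofReal_ne_top h.excess_ne_top

variable [IsProbabilityMeasure P]

/-- Each of the sums involved has a finite mean. -/
lemma ae_regularInput (h : IsLpInput P ν α x r p ξt e) : ∀ᵐ ω ∂P, RegularInput α x r ξt e ω := by
  have h1 : ∀ᵐ ω ∂P, ∀ u, powerSum r (ξt u ω) < ∞ := by
    refine ae_all_iff.2 fun u => ae_lt_top ((measurable_powerSum r).comp
      (h.input.measurable_ratio u)) ?_
    rw [h.input.lintegral_powerSum u h.exponent_pos, h.moment_eq_one]
    exact ENNReal.one_ne_top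
  have h2 : ∀ᵐ ω ∂P, ∀ n, genSum n (fun u => mass x ξt r u ω) < ∞ := by
    have hm : ∀ n, Measurable fun ω => genSum n (fun u => mass x ξt r u ω) := fun n =>
      Measurable.tsum fun u => by
        split_ifs
        exacts [measurable_mass h.input.measurable_ratio r u, measurable_const]
    refine ae_all_iff.2 fun n => ae_lt_top (hm n) ?_
    rw [lintegral_genSum fun u => (measurable_mass h.input.measurable_ratio r u).aemeasurable,
      h.input.genSum_lintegral_mass h.size_pos h.exponent_pos, h.moment_eq_one]
    simp
  have hb : ∀ u, Measurable fun ω =>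
      ENNReal.ofReal (Real.exp (-birth α x ξt e u ω)) * mass x ξt r u ω := fun u =>
    (measurable_birth α x h.input.measurable_ratio
      h.input.measurable_exp u).neg.exp.ennreal_ofReal.mul
      (measurable_mass h.input.measurable_ratio r u)
  have h3 : ∀ᵐ ω ∂P,
      ∑' u, ENNReal.ofReal (Real.exp (-birth α x ξt e u ω)) * mass x ξt r u ω < ∞ := by
    refine ae_lt_top (Measurable.tsum hb) ?_
    rw [lintegral_tsum fun u => (hb u).aemeasurable]
    exact h.input.tsum_lintegral_exp_neg_birth_ne_top h.nonneg_index h.size_pos h.exponent_pos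
      (by nlinarith [h.one_lt, h.exponent_pos]) h.moment_eq_one h.moment_lt_one
  filter_upwards [h.input.ae_goodInput, h1, h2, h3] with ω g1 g2 g3 g4
  refine ⟨g1, fun u => (g2 u).ne, fun n => ?_, ?_⟩
  · induction n with
    | zero => simp
    | succ n ih =>
      have h5 := ENNReal.summable_toReal (g3 n).ne
      classical
      convert ih.add h5 using 1
      funext u
      have hw : weight x ξt r ω u = (mass x ξt r u ω).toReal :=
        (ENNReal.toReal_ofReal (g1.weight_nonneg h.size_pos u)).symm
      rcases lt_trichotomy u.length n with h6 | h6 | h6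
      · simp [h6, h6.ne, h6.le]
      · simp [h6, hw]
      · simp [h6.ne', not_lt.2 h6.le, not_le.2 h6]
  · have h5 := ENNReal.summable_toReal g4.ne
    convert h5 using 1
    funext u
    rw [ENNReal.toReal_mul, ENNReal.toReal_ofReal (Real.exp_nonneg _)]
    congr 1
    exact (ENNReal.toReal_ofReal (g1.weight_nonneg h.size_pos u)).symm

lemma integrable_tsum_exp_neg_birth (h : IsLpInput P ν α x r p ξt e) :
    Integrable (fun ω => ∑' u, Real.exp (-birth α x ξt e u ω) * weight x ξt r ω u) P := by
  have hb : ∀ u, Measurable fun ω =>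
      ENNReal.ofReal (Real.exp (-birth α x ξt e u ω)) * mass x ξt r u ω := fun u =>
    (measurable_birth α x h.input.measurable_ratio
      h.input.measurable_exp u).neg.exp.ennreal_ofReal.mul
      (measurable_mass h.input.measurable_ratio r u)
  have h1 : Integrable (fun ω =>
      (∑' u, ENNReal.ofReal (Real.exp (-birth α x ξt e u ω)) * mass x ξt r u ω).toReal) P := by
    refine integrable_toReal_of_lintegral_ne_top (Measurable.tsum hb).aemeasurable ?_
    rw [lintegral_tsum fun u => (hb u).aemeasurable]
    exact h.input.tsum_lintegral_exp_neg_birth_ne_top h.nonneg_index h.size_pos h.exponent_pos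
      (by nlinarith [h.one_lt, h.exponent_pos]) h.moment_eq_one h.moment_lt_one
  refine h1.congr (h.input.ae_goodInput.mono fun ω hω => ?_)
  simp only
  rw [ENNReal.tsum_toReal_eq (f := fun u =>
    ENNReal.ofReal (Real.exp (-birth α x ξt e u ω)) * mass x ξt r u ω) fun u =>
      ENNReal.mul_ne_top ENNReal.ofReal_ne_top ENNReal.ofReal_ne_top]
  refine tsum_congr fun u => ?_
  rw [ENNReal.toReal_mul, ENNReal.toReal_ofReal (Real.exp_nonneg _)]
  congr 1
  exact ENNReal.toReal_ofReal (hω.weight_nonneg h.size_pos u)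

lemma lintegral_rpow_le_of_hasSum (h : IsLpInput P ν α x r p ξt e) {E : Node → Set Ω}
    (hE : IsPredictable ξt e E) {Z : Ω → ℝ}
    (hZ : ∀ᵐ ω ∂P, HasSum (fun u => (E u).indicator (increment x ξt r u) ω) (Z ω)) :
    ∫⁻ ω, ‖Z ω‖ₑ ^ p ∂P ≤
      lpConst ν r p * ∑' u, ∫⁻ ω, (E u).indicator (mass x ξt (p * r) u) ω ∂P := by
  refine le_trans (le_of_eq ?_) (h.input.lintegral_tsum_increment_rpow_le h.size_pos
    h.exponent_pos h.one_lt h.le_two h.moment_eq_one h.moment_lt_one h.excess_ne_top hE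
    (hZ.mono fun ω hω => hω.summable))
  exact lintegral_congr_ae (hZ.mono fun ω hω => by simp only [hω.tsum_eq])

lemma lintegral_genM_succ_sub_rpow_le (h : IsLpInput P ν α x r p ξt e) (n : ℕ) :
    ∫⁻ ω, ‖genM x ξt r (n + 1) ω - genM x ξt r n ω‖ₑ ^ p ∂P ≤
      lpConst ν r p * (powerMoment ν (p * r) ^ n * ENNReal.ofReal (x ^ (p * r))) := by
  refine (h.lintegral_rpow_le_of_hasSum (isPredictable_const fun u => u.length = n)
    (h.ae_regularInput.mono fun ω hω => hω.hasSum_genM_succ_sub h.size_pos n)).trans ?_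
  rw [← h.input.genSum_lintegral_mass h.size_pos
    (mul_pos (by linarith [h.one_lt]) h.exponent_pos), genSum]
  gcongr with u
  split_ifs with hu <;> simp [hu]

lemma lintegral_genM_sub_rpow_le (h : IsLpInput P ν α x r p ξt e) (n : ℕ) :
    ∫⁻ ω, ‖genM x ξt r n ω - x ^ r‖ₑ ^ p ∂P ≤
      lpConst ν r p * ∑' u, ∫⁻ ω, mass x ξt (p * r) u ω ∂P := by
  refine (h.lintegral_rpow_le_of_hasSum (isPredictable_const fun u => u.length < n)
    (h.ae_regularInput.mono fun ω hω => hω.hasSum_genM_sub_rpow h.size_pos n)).trans ?_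
  gcongr with u ω
  exact Set.indicator_le_self _ _ _

/-- A bound for the `p`-th moment of the difference between the intrinsic martingale and `M`. -/
noncomputable def _root_.BranchingChain.remainder (P : Measure Ω) (α x q : ℝ)
    (ξt : Node → Ω → ℕ → ℝ) (e : Node → Ω → ℝ) (t : ℝ≥0) : ℝ≥0∞ :=
  ∑' u, ∫⁻ ω, {ω | (t : ℝ) < birth α x ξt e u ω + lifetime α x ξt e u ω}.indicator
    (mass x ξt q u) ω ∂P

lemma lintegral_genM_sub_lineSum_rpow_le (h : IsLpInput P ν α x r p ξt e) (t : ℝ≥0) (n : ℕ) :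
    ∫⁻ ω, ‖genM x ξt r n ω - lineSum α x r ξt e t n ω‖ₑ ^ p ∂P ≤
      lpConst ν r p * remainder P α x (p * r) ξt e t := by
  refine (h.lintegral_rpow_le_of_hasSum (isPredictable_diesAfter t n)
    (h.ae_regularInput.mono fun ω hω =>
      hω.hasSum_genM_sub_lineSum h.size_pos h.exponent_pos t n)).trans ?_
  rw [remainder]
  gcongr with u ω
  exact fun _ hω => hω.2

/-- Dominated convergence twice, in the mean for each `u`, which is dead from some time on, and then
in the sum over `u`; the mass of order `p * r` of the whole tree is the majorant. -/
lemma tendsto_remainder (h : IsLpInput P ν α x r p ξt e) :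
    Tendsto (remainder P α x (p * r) ξt e) atTop (𝓝 0) := by
  have hq : 0 < p * r := mul_pos (by linarith [h.one_lt]) h.exponent_pos
  have hfin := h.input.tsum_lintegral_mass_ne_top h.size_pos hq h.moment_lt_one
  have hle : ∀ (t : ℝ≥0) u, ∫⁻ ω, {ω | (t : ℝ) < birth α x ξt e u ω +
      lifetime α x ξt e u ω}.indicator (mass x ξt (p * r) u) ω ∂P ≤
      ∫⁻ ω, mass x ξt (p * r) u ω ∂P := fun t u =>
    lintegral_mono fun ω => Set.indicator_le_self _ _ _
  have h1 : ∀ u, Tendsto (fun t : ℝ≥0 => ∫⁻ ω, {ω | (t : ℝ) < birth α x ξt e u ω +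
      lifetime α x ξt e u ω}.indicator (mass x ξt (p * r) u) ω ∂P) atTop (𝓝 0) := fun u => by
    rw [← lintegral_zero (μ := P)]
    refine tendsto_lintegral_filter_of_dominated_convergence (mass x ξt (p * r) u)
      (Eventually.of_forall fun t => ?_) (Eventually.of_forall fun t => ae_of_all _ fun ω =>
        Set.indicator_le_self _ _ _) (ENNReal.ne_top_of_tsum_ne_top hfin u)
      (ae_of_all _ fun ω => ?_)
    · exact (measurable_mass h.input.measurable_ratio _ u).indicator
        (measurableSet_lt measurable_const ((measurable_birth α x h.input.measurable_ratio
          h.input.measurable_exp u).fun_add (measurable_lifetime α x h.input.measurable_ratio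
          h.input.measurable_exp u)))
    · refine tendsto_const_nhds.congr' ?_
      have h2 : Tendsto (fun t : ℝ≥0 => (t : ℝ)) atTop atTop :=
        NNReal.tendsto_coe_atTop.2 tendsto_id
      filter_upwards [h2.eventually_ge_atTop (birth α x ξt e u ω + lifetime α x ξt e u ω)]
        with t ht
      rw [Set.indicator_of_notMem]
      exact not_lt.2 ht
  have h2 : Tendsto (fun t : ℝ≥0 => ∑' u, (∫⁻ ω, {ω | (t : ℝ) < birth α x ξt e u ω +
      lifetime α x ξt e u ω}.indicator (mass x ξt (p * r) u) ω ∂P).toReal) atTop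
      (𝓝 (∑' _ : Node, (0 : ℝ))) := by
    refine tendsto_tsum_of_dominated_convergence (ENNReal.summable_toReal hfin) (fun u => ?_)
      (Eventually.of_forall fun t u => ?_)
    · exact (ENNReal.tendsto_toReal ENNReal.zero_ne_top).comp (h1 u)
    · rw [Real.norm_of_nonneg ENNReal.toReal_nonneg]
      exact ENNReal.toReal_mono (ENNReal.ne_top_of_tsum_ne_top hfin u) (hle t u)
  have h3 : ∀ t : ℝ≥0, remainder P α x (p * r) ξt e t = ENNReal.ofReal (∑' u, (∫⁻ ω,
      {ω | (t : ℝ) < birth α x ξt e u ω + lifetime α x ξt e u ω}.indicator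
        (mass x ξt (p * r) u) ω ∂P).toReal) := fun t => by
    have ht := ne_top_of_le_ne_top hfin (ENNReal.tsum_le_tsum (hle t))
    rw [← ENNReal.tsum_toReal_eq fun u => ENNReal.ne_top_of_tsum_ne_top ht u,
      ENNReal.ofReal_toReal ht, remainder]
  have h4 := (ENNReal.continuous_ofReal.tendsto _).comp h2
  rw [tsum_zero, ENNReal.ofReal_zero] at h4
  exact h4.congr fun t => (h3 t).symm

/-! ### Convergence of the intrinsic martingale -/

/-- The `L^1` norm is at most the `L^p` norm, which decays geometrically with ratio `powerMoment ν
(p * r) ^ (1 / p)`. -/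
lemma tsum_lintegral_genM_succ_sub_ne_top (h : IsLpInput P ν α x r p ξt e) :
    ∑' n, ∫⁻ ω, ‖genM x ξt r (n + 1) ω - genM x ξt r n ω‖ₑ ∂P ≠ ∞ := by
  have hp : 0 < p := by linarith [h.one_lt]
  have hbound : ∀ n, ∫⁻ ω, ‖genM x ξt r (n + 1) ω - genM x ξt r n ω‖ₑ ∂P ≤
      (lpConst ν r p * ENNReal.ofReal (x ^ (p * r))) ^ (1 / p) *
        (powerMoment ν (p * r) ^ (1 / p)) ^ n := fun n => by
    have h1 : AEStronglyMeasurable (fun ω => genM x ξt r (n + 1) ω - genM x ξt r n ω) P :=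
      ((h.aemeasurable_genM _).sub (h.aemeasurable_genM n)).aestronglyMeasurable
    have h2 : (1 : ℝ≥0∞) ≤ ENNReal.ofReal p := by
      simpa using ENNReal.ofReal_le_ofReal h.one_lt.le
    rw [← eLpNorm_one_eq_lintegral_enorm]
    refine (eLpNorm_le_eLpNorm_of_exponent_le h2 h1).trans ?_
    rw [eLpNorm_ofReal_eq hp]
    calc _ ≤ (lpConst ν r p * (powerMoment ν (p * r) ^ n *
          ENNReal.ofReal (x ^ (p * r)))) ^ (1 / p) :=
          ENNReal.rpow_le_rpow (h.lintegral_genM_succ_sub_rpow_le n) (by positivity)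
      _ = _ := by
          rw [mul_comm (_ ^ n), ← mul_assoc, ENNReal.mul_rpow_of_nonneg _ _ (by positivity),
            ← ENNReal.rpow_natCast, ← ENNReal.rpow_natCast, ← ENNReal.rpow_mul,
            ← ENNReal.rpow_mul, mul_comm (n : ℝ)]
  refine ne_top_of_le_ne_top ?_ (ENNReal.tsum_le_tsum hbound)
  rw [ENNReal.tsum_mul_left, ENNReal.tsum_geometric]
  refine ENNReal.mul_ne_top (ENNReal.rpow_ne_top_of_nonneg (by positivity)
    (ENNReal.mul_ne_top h.lpConst_ne_top ENNReal.ofReal_ne_top)) (ENNReal.inv_ne_top.2 ?_)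
  exact (tsub_pos_of_lt (ENNReal.rpow_lt_one h.moment_lt_one (by positivity))).ne'

lemma ae_tsum_enorm_genM_succ_sub_lt_top (h : IsLpInput P ν α x r p ξt e) :
    ∀ᵐ ω ∂P, ∑' n, ‖genM x ξt r (n + 1) ω - genM x ξt r n ω‖ₑ < ∞ := by
  have hm : ∀ n, AEMeasurable (fun ω => ‖genM x ξt r (n + 1) ω - genM x ξt r n ω‖ₑ) P := fun n =>
    ((h.aemeasurable_genM _).sub (h.aemeasurable_genM n)).enorm
  refine ae_lt_top' (AEMeasurable.tsum hm) ?_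
  rw [lintegral_tsum hm]
  exact h.tsum_lintegral_genM_succ_sub_ne_top

lemma ae_tendsto_genM (h : IsLpInput P ν α x r p ξt e) :
    ∀ᵐ ω ∂P, Tendsto (fun n => genM x ξt r n ω) atTop (𝓝 (genMLimit x ξt r ω)) := by
  filter_upwards [h.ae_tsum_enorm_genM_succ_sub_lt_top] with ω hω
  refine tendsto_nhds_limUnder (cauchySeq_tendsto_of_complete
    (cauchySeq_of_edist_le_of_tsum_ne_top _ (fun n => ?_) hω.ne))
  rw [edist_comm, edist_eq_enorm_sub]

/-- The majorant is the initial weight plus the total variation of `n ↦ M_n`. -/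
lemma exists_integrable_bound_genM (h : IsLpInput P ν α x r p ξt e) :
    ∃ G : Ω → ℝ, Integrable G P ∧ ∀ᵐ ω ∂P, ∀ n, |genM x ξt r n ω| ≤ G ω := by
  have hm : ∀ n, AEMeasurable (fun ω => ‖genM x ξt r (n + 1) ω - genM x ξt r n ω‖ₑ) P := fun n =>
    ((h.aemeasurable_genM _).sub (h.aemeasurable_genM n)).enorm
  refine ⟨fun ω => x ^ r + (∑' n, ‖genM x ξt r (n + 1) ω - genM x ξt r n ω‖ₑ).toReal,
    (integrable_const _).add (integrable_toReal_of_lintegral_ne_top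
      (AEMeasurable.tsum hm) ?_), ?_⟩
  · rw [lintegral_tsum hm]
    exact h.tsum_lintegral_genM_succ_sub_ne_top
  filter_upwards [h.ae_tsum_enorm_genM_succ_sub_lt_top] with ω hω n
  have hs := ENNReal.summable_toReal hω.ne
  rw [ENNReal.tsum_toReal_eq fun n => ENNReal.ne_top_of_tsum_ne_top hω.ne n]
  simp only [toReal_enorm] at hs ⊢
  have h1 : genM x ξt r n ω = x ^ r +
      ∑ k ∈ Finset.range n, (genM x ξt r (k + 1) ω - genM x ξt r k ω) := by
    rw [Finset.sum_range_sub (fun k => genM x ξt r k ω), RegularInput.genM_zero]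
    ring
  rw [h1]
  refine (abs_add_le _ _).trans ?_
  rw [abs_of_nonneg (Real.rpow_nonneg h.size_pos.le r)]
  gcongr
  exact (Finset.abs_sum_le_sum_abs _ _).trans (hs.sum_le_tsum _ fun k _ => abs_nonneg _)

lemma aestronglyMeasurable_genMLimit (h : IsLpInput P ν α x r p ξt e) :
    AEStronglyMeasurable (genMLimit x ξt r) P :=
  aestronglyMeasurable_of_tendsto_ae atTop
    (fun n => (h.aemeasurable_genM n).aestronglyMeasurable) h.ae_tendsto_genM

lemma memLp_genMLimit (h : IsLpInput P ν α x r p ξt e) :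
    MemLp (genMLimit x ξt r) (ENNReal.ofReal p) P := by
  have hp : 0 < p := by linarith [h.one_lt]
  have h1 : MemLp (fun ω => genMLimit x ξt r ω - x ^ r) (ENNReal.ofReal p) P := by
    refine ⟨h.aestronglyMeasurable_genMLimit.sub aestronglyMeasurable_const, ?_⟩
    rw [eLpNorm_ofReal_eq hp]
    refine ENNReal.rpow_lt_top_of_nonneg (by positivity) (ne_top_of_le_ne_top
      (ENNReal.mul_ne_top h.lpConst_ne_top (h.input.tsum_lintegral_mass_ne_top h.size_pos
        (mul_pos hp h.exponent_pos) h.moment_lt_one)) ?_)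
    exact lintegral_rpow_enorm_le_of_tendsto (fun n => (h.aemeasurable_genM n).sub_const _)
      (h.ae_tendsto_genM.mono fun ω hω => hω.sub_const _) h.lintegral_genM_sub_rpow_le
  exact (h1.add (memLp_const (x ^ r))).ae_eq (ae_of_all _ fun ω => by simp)

lemma integrable_genMLimit (h : IsLpInput P ν α x r p ξt e) : Integrable (genMLimit x ξt r) P :=
  h.memLp_genMLimit.integrable (by simpa using ENNReal.ofReal_le_ofReal h.one_lt.le)

/-! ### The process `M` -/

lemma ae_tendsto_lineSum (h : IsLpInput P ν α x r p ξt e) (t : ℝ≥0) :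
    ∀ᵐ ω ∂P, Tendsto (fun n => lineSum α x r ξt e t n ω) atTop (𝓝 (M α x ξt e r t ω)) :=
  h.ae_regularInput.mono fun _ hω => hω.tendsto_lineSum h.size_pos t

lemma ae_integrable_X (h : IsLpInput P ν α x r p ξt e) (t : ℝ≥0) :
    ∀ᵐ ω ∂P, Integrable (fun y : ℝ => y ^ r) (X α x ξt e t ω) := by
  classical
  filter_upwards [h.ae_regularInput] with ω hω
  have hs : Summable ({u | Alive α x ξt e t u ω}.indicator (weight x ξt r ω)) :=
    (hω.summable_birth.mul_left _).of_nonneg_of_le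
      (fun u => Set.indicator_nonneg (fun u _ => hω.good.weight_nonneg h.size_pos u) u)
      (hω.good.indicator_weight_le h.size_pos fun u hu => hu.2.1)
  have hpos : ∀ᵐ y ∂(X α x ξt e t ω), 0 < y := by
    rw [X, Measure.ae_sum_iff]
    intro u
    split_ifs with hu
    · rw [ae_dirac_eq]
      exact hu.1
    · simp
  refine ⟨(measurable_id.pow_const r).aestronglyMeasurable, ?_⟩
  rw [hasFiniteIntegral_iff_ofReal (hpos.mono fun y hy => Real.rpow_nonneg hy.le r), lintegral_X]
  convert hs.tsum_ofReal_lt_top using 3 with u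
  by_cases hu : Alive α x ξt e t u ω <;> simp [hu, mass, weight]

lemma _root_.BranchingChain.stronglyMeasurable_M (hξ : ∀ u, Measurable (ξt u))
    (he : ∀ u, Measurable (e u)) (t : ℝ≥0) :
    StronglyMeasurable[natFiltration α x hξ he t] (M α x ξt e r t) := by
  have h1 : M α x ξt e r t =
      (fun μ : Measure ℝ => (∫⁻ y, ENNReal.ofReal (y ^ r) ∂μ).toReal) ∘ X α x ξt e t :=
    funext fun ω => M_eq_toReal t ω
  have h2 : Measurable[natFiltration α x hξ he t] (X α x ξt e t) := by
    rw [measurable_iff_comap_le]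
    exact le_iSup₂_of_le t le_rfl le_rfl
  rw [h1]
  exact ((Measure.measurable_lintegral (measurable_ofReal_rpow r)).ennreal_toReal.comp
    h2).stronglyMeasurable

lemma lintegral_limit_sub_M_rpow_le (h : IsLpInput P ν α x r p ξt e) (t : ℝ≥0) :
    ∫⁻ ω, ‖genMLimit x ξt r ω - M α x ξt e r t ω‖ₑ ^ p ∂P ≤
      lpConst ν r p * remainder P α x (p * r) ξt e t := by
  refine lintegral_rpow_enorm_le_of_tendsto
    (fun n => (h.aemeasurable_genM n).sub (h.aemeasurable_lineSum t n)) ?_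
    (h.lintegral_genM_sub_lineSum_rpow_le t)
  filter_upwards [h.ae_tendsto_genM, h.ae_tendsto_lineSum t] with ω h1 h2
  exact h1.sub h2

lemma memLp_limit_sub_M (h : IsLpInput P ν α x r p ξt e) (t : ℝ≥0) :
    MemLp (fun ω => genMLimit x ξt r ω - M α x ξt e r t ω) (ENNReal.ofReal p) P := by
  have hp : 0 < p := by linarith [h.one_lt]
  refine ⟨h.aestronglyMeasurable_genMLimit.sub ((stronglyMeasurable_M h.input.measurable_ratio
    h.input.measurable_exp t).mono (Filtration.le _ t)).aestronglyMeasurable, ?_⟩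
  rw [eLpNorm_ofReal_eq hp]
  refine ENNReal.rpow_lt_top_of_nonneg (by positivity) (ne_top_of_le_ne_top
    (ENNReal.mul_ne_top h.lpConst_ne_top ?_) (h.lintegral_limit_sub_M_rpow_le t))
  refine ne_top_of_le_ne_top (h.input.tsum_lintegral_mass_ne_top h.size_pos
    (mul_pos hp h.exponent_pos) h.moment_lt_one) (ENNReal.tsum_le_tsum fun u => ?_)
  exact lintegral_mono fun ω => Set.indicator_le_self _ _ _

lemma memLp_M (h : IsLpInput P ν α x r p ξt e) (t : ℝ≥0) :
    MemLp (M α x ξt e r t) (ENNReal.ofReal p) P := by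
  have := h.memLp_genMLimit.sub (h.memLp_limit_sub_M t)
  refine this.ae_eq (ae_of_all _ fun ω => ?_)
  simp

lemma tendsto_eLpNorm_M_sub_limit (h : IsLpInput P ν α x r p ξt e) :
    Tendsto (fun t : ℝ≥0 => eLpNorm (M α x ξt e r t - genMLimit x ξt r) (ENNReal.ofReal p) P)
      atTop (𝓝 0) := by
  have hp : 0 < p := by linarith [h.one_lt]
  have h1 : Tendsto (fun t : ℝ≥0 => (lpConst ν r p * remainder P α x (p * r) ξt e t) ^ (1 / p))
      atTop (𝓝 0) := by
    have h2 := ENNReal.Tendsto.const_mul h.tendsto_remainder (Or.inr h.lpConst_ne_top)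
    have h3 := (ENNReal.continuous_rpow_const (y := 1 / p)).tendsto (lpConst ν r p * 0)
    have h4 := h3.comp h2
    rwa [mul_zero, ENNReal.zero_rpow_of_pos (by positivity)] at h4
  refine tendsto_of_tendsto_of_tendsto_of_le_of_le tendsto_const_nhds h1 (fun _ => zero_le)
    fun t => ?_
  simp only
  rw [eLpNorm_sub_comm, eLpNorm_ofReal_eq hp]
  exact ENNReal.rpow_le_rpow (h.lintegral_limit_sub_M_rpow_le t) (by positivity)

/-! ### The martingale property -/

/-- The sum of increments is integrated term by term, each term having integral zero over `A`. -/
lemma setIntegral_genM_sub_lineSum [IsProbabilityMeasure ν] (h : IsLpInput P ν α x r p ξt e)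
    (t : ℝ≥0) (n : ℕ) {A : Set Ω}
    (hA : MeasurableSet[natFiltration α x h.input.measurable_ratio h.input.measurable_exp t] A) :
    ∫ ω in A, (genM x ξt r n ω - lineSum α x r ξt e t n ω) ∂P = 0 := by
  have hE := isPredictable_diesAfter (α := α) (x := x) (ξt := ξt) (e := e) t n
  have h1 : ∀ᵐ ω ∂P.restrict A, genM x ξt r n ω - lineSum α x r ξt e t n ω =
      ∑' u, (diesAfter α x ξt e t n u).indicator (increment x ξt r u) ω :=
    ae_restrict_of_ae (h.ae_regularInput.mono fun ω hω =>
      (hω.hasSum_genM_sub_lineSum h.size_pos h.exponent_pos t n).tsum_eq.symm)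
  have hK : excessMoment ν r 1 ≠ ∞ := by
    have hm : ∫⁻ s, (∫⁻ y, ENNReal.ofReal (y ^ r) ∂s.1) ^ (1 : ℝ) ∂ν < ∞ := by
      simp only [ENNReal.rpow_one]
      exact (le_of_eq h.moment_eq_one).trans_lt ENNReal.one_lt_top
    exact excessMoment_ne_top le_rfl hm
  rw [integral_congr_ae h1, integral_tsum
    (fun u => (h.input.measurable_indicator_increment r hE u).aestronglyMeasurable)]
  · simp [h.input.setIntegral_diesAfter_increment h.size_pos h.exponent_pos h.moment_eq_one t n
      _ hA]
  -- Absolute convergence in `L^1`: only generations `k < n` occur, and each has mean weight `x ^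
  -- r`.
  · refine ne_top_of_le_ne_top (b := ∑ k ∈ Finset.range n, genSum k
      (fun u => (∫⁻ ω, mass x ξt r u ω ∂P) * excessMoment ν r 1)) ?_ ?_
    · refine ENNReal.sum_ne_top.2 fun k _ => ?_
      simp only [mul_comm _ (excessMoment ν r 1), genSum_const_mul,
        h.input.genSum_lintegral_mass h.size_pos h.exponent_pos, h.moment_eq_one]
      exact ENNReal.mul_ne_top hK (by simp)
    · simp only [genSum]
      rw [← Summable.tsum_finsetSum fun k _ => ENNReal.summable]
      refine ENNReal.tsum_le_tsum fun u => ?_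
      have h2 := h.input.lintegral_indicator_increment h.size_pos h.exponent_pos one_pos
        (hE u u (not_suffix_and_ne_self u))
      simp only [ENNReal.rpow_one, one_mul] at h2
      refine (setLIntegral_le_lintegral _ _).trans ?_
      rw [h2]
      by_cases hu : u.length < n
      · rw [Finset.sum_ite_eq, if_pos (Finset.mem_range.2 hu)]
        gcongr
        exact Set.indicator_le_self _ _ _
      · simp [diesAfter, hu]

/-- Passage to the limit `n → ∞` in `setIntegral_genM_sub_lineSum`, dominated by the majorant of
`M_n` plus `exp t` times the sum of the `exp(-a_u) ξ_u ^ r`. -/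
lemma setIntegral_M [IsProbabilityMeasure ν] (h : IsLpInput P ν α x r p ξt e) (t : ℝ≥0) {A : Set Ω}
    (hA : MeasurableSet[natFiltration α x h.input.measurable_ratio h.input.measurable_exp t] A) :
    ∫ ω in A, M α x ξt e r t ω ∂P = ∫ ω in A, genMLimit x ξt r ω ∂P := by
  obtain ⟨G, hG, hGb⟩ := h.exists_integrable_bound_genM
  have hMi : Integrable (M α x ξt e r t) P :=
    (h.memLp_M t).integrable (by simpa using ENNReal.ofReal_le_ofReal h.one_lt.le)
  have h1 : Tendsto (fun n => ∫ ω in A, (genM x ξt r n ω - lineSum α x r ξt e t n ω) ∂P) atTop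
      (𝓝 (∫ ω in A, (genMLimit x ξt r ω - M α x ξt e r t ω) ∂P)) := by
    refine tendsto_integral_of_dominated_convergence
      (fun ω => G ω + Real.exp t * ∑' u, Real.exp (-birth α x ξt e u ω) * weight x ξt r ω u)
      (fun n => ((h.aemeasurable_genM n).sub
        (h.aemeasurable_lineSum t n)).aestronglyMeasurable.restrict)
      (hG.add (h.integrable_tsum_exp_neg_birth.const_mul _)).integrableOn
      (fun n => ae_restrict_of_ae ?_) (ae_restrict_of_ae ?_)
    · filter_upwards [hGb, h.ae_regularInput] with ω g1 g2
      exact (abs_sub _ _).trans (add_le_add (g1 n) (g2.abs_lineSum_le h.size_pos t n))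
    · filter_upwards [h.ae_tendsto_genM, h.ae_tendsto_lineSum t] with ω g1 g2
      exact g1.sub g2
  simp only [h.setIntegral_genM_sub_lineSum t _ hA] at h1
  have h2 := tendsto_nhds_unique h1 tendsto_const_nhds
  rw [integral_sub h.integrable_genMLimit.integrableOn hMi.integrableOn] at h2
  linarith

lemma M_ae_eq_condExp [IsProbabilityMeasure ν] (h : IsLpInput P ν α x r p ξt e) (t : ℝ≥0) :
    M α x ξt e r t =ᵐ[P] P[genMLimit x ξt r |
      natFiltration α x h.input.measurable_ratio h.input.measurable_exp t] := by
  have hMi : Integrable (M α x ξt e r t) P :=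
    (h.memLp_M t).integrable (by simpa using ENNReal.ofReal_le_ofReal h.one_lt.le)
  exact ae_eq_condExp_of_forall_setIntegral_eq (Filtration.le _ t) h.integrable_genMLimit
    (fun _ _ _ => hMi.integrableOn) (fun A hA _ => h.setIntegral_M t hA)
    (stronglyMeasurable_M h.input.measurable_ratio h.input.measurable_exp t).aestronglyMeasurable

lemma martingale_M [IsProbabilityMeasure ν] (h : IsLpInput P ν α x r p ξt e) :
    Martingale (M α x ξt e r)
    (natFiltration α x h.input.measurable_ratio h.input.measurable_exp) P := by
  refine ⟨fun t => stronglyMeasurable_M _ _ t, fun s t hst => ?_⟩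
  exact (condExp_congr_ae (h.M_ae_eq_condExp t)).trans
    ((condExp_condExp_of_le (Filtration.mono _ hst) (Filtration.le _ t)).trans
      (h.M_ae_eq_condExp s).symm)

end IsLpInput

end Convergence

end BranchingChain

theorem mainTheorem5 {Ω : Type*} [MeasurableSpace Ω] (P : Measure Ω) [IsProbabilityMeasure P]
    (ν : Measure PointMeasure) [IsProbabilityMeasure ν]
    (α : ℝ) (hα : 0 ≤ α) (p₀ : ℝ) (hν : MalthusianHypotheses ν p₀)
    (hF : NonExplosionCondition ν)
    (x : ℝ) (hx : 0 < x)
    (ξt : Node → Ω → ℕ → ℝ) (e : Node → Ω → ℝ) (h : IsTreeInput P ν ξt e) :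
    -- the sum defining `M(t)` is almost surely finite
    (∀ t : ℝ≥0, ∀ᵐ ω ∂P, Integrable (fun y : ℝ => y ^ p₀) (X α x ξt e t ω)) ∧
    -- the intrinsic martingale converges to its terminal value
    (∀ᵐ ω ∂P, Tendsto (fun n => genM x ξt p₀ n ω) atTop (𝓝 (genMLimit x ξt p₀ ω))) ∧
    Martingale (M α x ξt e p₀)
      (natFiltration α x h.measurable_ratio h.measurable_exp) P ∧
    Integrable (genMLimit x ξt p₀) P ∧
    (∀ t : ℝ≥0, M α x ξt e p₀ t =ᵐ[P]
      P[genMLimit x ξt p₀ | natFiltration α x h.measurable_ratio h.measurable_exp t]) ∧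
    (∃ p : ℝ, 1 < p ∧
      (∀ t : ℝ≥0, MemLp (M α x ξt e p₀ t) (ENNReal.ofReal p) P) ∧
      MemLp (genMLimit x ξt p₀) (ENNReal.ofReal p) P ∧
      Tendsto (fun t : ℝ≥0 => eLpNorm (M α x ξt e p₀ t - genMLimit x ξt p₀) (ENNReal.ofReal p) P)
        atTop (𝓝 0)) := by
  obtain ⟨p, hp1, hp2, hq, hm⟩ := hν.exists_exponent
  have H : IsLpInput P ν α x p₀ p ξt e :=
    ⟨h, hα, hx, hν.pos, hp1, hp2, hν.powerMoment_eq_one, hq, excessMoment_ne_top hp1.le hm⟩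
  exact ⟨H.ae_integrable_X, H.ae_tendsto_genM, H.martingale_M, H.integrable_genMLimit,
    H.M_ae_eq_condExp, p, hp1, H.memLp_M, H.memLp_genMLimit, H.tendsto_eLpNorm_M_sub_limit⟩
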